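/- Let $F$ denote Thompson's group, given by either of the isomorphic presentations $\langle A,B \mid [A,(AB)^{-1}B(AB)],\,[A,(AB)^{-2}B(AB)^2]\rangle$ and $\langle a,b \mid [ab^{-1},a^{-1}ba],\,[ab^{-1},a^{-2}ba^2]\rangle$. Let $F_1$ and $F_2$ be two copies of $F$ given by the second presentation, with generators $p_1,p_2$ and $q_1,q_2$ respectively (in the roles of $a,b$), and let $P$ be the subgroup of $F_1\times F_2$ generated by $(p_1,q_2)$ and $(p_2,q_1)$. Let $\mathrm{Homeo}^+(I)$ be the group of orientation-preserving homeomorphisms of $I=[0,1]$, and for $f$ in it write $\mathrm{supp}\, f=\{x\in I : f(x)\neq x\}$. A subgroup $G<\mathrm{Homeo}^+(I)$ is a *square root of Thompson's group* if $G=\langle f,g\rangle$ for some $f,g$ such that $\mathrm{supp}\, f$ and $\mathrm{supp}\, g$ are nonempty open intervals, $\mathrm{supp}\, f\cap\mathrm{supp}\, g$ is a nonempty proper subinterval of each of them, and $\langle f^2,g^2\rangle\cong F$. Let $H$ be a group generated by two elements $h_1,h_2$ that admits a surjective homomorphism $H\to P$ with $h_1\mapsto(p_1,q_2)$ and $h_2\mapsto(p_2,q_1)$,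 and suppose that $H$ is left orderable, i.e. admits a total order invariant under left multiplication. Then there exists a square root $G$ of Thompson's group such that $H$ is isomorphic to a subgroup of $G$. -/

import Mathlib

namespace SquareRootsOfF

open scoped commutatorElement

/-- The relators `[A, (AB)⁻ᵏ B (AB)ᵏ]`, `k = 1, 2`, of Thompson's group `F`. -/
def relsAB : Set (FreeGroup (Fin 2)) :=
  let A := FreeGroup.of (0 : Fin 2)
  let B := FreeGroup.of (1 : Fin 2)
  {⁅A, (A * B)⁻¹ * B * (A * B)⁆, ⁅A, ((A * B) ^ 2)⁻¹ * B * (A * B) ^ 2⁆}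

/-- Thompson's group `F`, by its presentation
`⟨A, B | [A, (AB)⁻¹ B (AB)], [A, (AB)⁻² B (AB)²]⟩`. -/
abbrev ThompsonF : Type := PresentedGroup relsAB

/-- The relators `[a b⁻¹, a⁻ᵏ b aᵏ]`, `k = 1, 2`, of Thompson's group `F`. -/
def relsNested : Set (FreeGroup (Fin 2)) :=
  let a := FreeGroup.of (0 : Fin 2)
  let b := FreeGroup.of (1 : Fin 2)
  {⁅a * b⁻¹, a⁻¹ * b * a⁆, ⁅a * b⁻¹, (a ^ 2)⁻¹ * b * a ^ 2⁆}

/-- Thompson's group `F`, by its second presentation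
`⟨a, b | [a b⁻¹, a⁻¹ b a], [a b⁻¹, a⁻² b a²]⟩`. Both factors of the product containing `P` are
copies of this group, with `p₁, q₁` the first generator and `p₂, q₂` the second one. -/
abbrev ThompsonF' : Type := PresentedGroup relsNested

/-- The generator `p₁` (also `q₁`). -/
def gen₁ : ThompsonF' := PresentedGroup.of (0 : Fin 2)

/-- The generator `p₂` (also `q₂`). -/
def gen₂ : ThompsonF' := PresentedGroup.of (1 : Fin 2)

/-- The subgroup `P` of `F × F` generated by `(p₁, q₂)` and `(p₂, q₁)`. -/
def P : Subgroup (ThompsonF' × ThompsonF') :=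
  Subgroup.closure {(gen₁, gen₂), (gen₂, gen₁)}

/-- `H = ⟨h₁, h₂⟩` is a marked extension of `P`: the elements `h₁, h₂` generate `H`, and there is
a surjective homomorphism `H → P` with `h₁ ↦ (p₁, q₂)` and `h₂ ↦ (p₂, q₁)`. -/
def IsMarkedExtension {H : Type*} [Group H] (h₁ h₂ : H) : Prop :=
  Subgroup.closure {h₁, h₂} = ⊤ ∧
    ∃ π : H →* P, Function.Surjective π ∧
      (π h₁ : ThompsonF' × ThompsonF') = (gen₁, gen₂) ∧
      (π h₂ : ThompsonF' × ThompsonF') = (gen₂, gen₁)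

/-- A group is left orderable if it admits a left invariant total order. -/
def LeftOrderable (H : Type*) [Group H] : Prop :=
  ∃ _ : LinearOrder H, ∀ a b c : H, a ≤ b → c * a ≤ c * b

/-- The group `Homeo⁺(I)` of orientation preserving (i.e. increasing) homeomorphisms of
`I = [0, 1]`. -/
def HomeoPlus : Subgroup (unitInterval ≃ₜ unitInterval) where
  carrier := {f | StrictMono f}
  mul_mem' := fun {_ _} hf hg => hf.comp hg
  one_mem' := strictMono_id
  inv_mem' := fun {f} hf x y hxy => hf.lt_iff_lt.mp (by
    change f (f.symm x) < f (f.symm y)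
    simpa using hxy)

/-- The support `{x | f x ≠ x}` of a homeomorphism. -/
def supp (f : HomeoPlus) : Set unitInterval :=
  {x | (f : unitInterval ≃ₜ unitInterval) x ≠ x}

/-- A nonempty open interval `(a, b)` in `I`. -/
def IsOpenInterval (J : Set unitInterval) : Prop :=
  ∃ a b : unitInterval, a < b ∧ J = Set.Ioo a b

/-- Two open intervals form a two-chain if their intersection is a nonempty subinterval which is
proper in each of them. -/
def IsTwoChain (J₁ J₂ : Set unitInterval) : Prop :=
  IsOpenInterval J₁ ∧ IsOpenInterval J₂ ∧ IsOpenInterval (J₁ ∩ J₂) ∧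
    J₁ ∩ J₂ ⊂ J₁ ∧ J₁ ∩ J₂ ⊂ J₂

/-- `G < Homeo⁺(I)` is a square root of Thompson's group `F`: it is generated by two elements
`f, g` whose supports form a two-chain of intervals and such that `⟨f², g²⟩ ≅ F`. -/
def IsSquareRootOfF (G : Subgroup HomeoPlus) : Prop :=
  ∃ f g : HomeoPlus, G = Subgroup.closure {f, g} ∧
    IsTwoChain (supp f) (supp g) ∧
    Nonempty (Subgroup.closure {f ^ 2, g ^ 2} ≃* ThompsonF)

end SquareRootsOfF

/-! The group `H` is realised inside `⟨f, g⟩` by two words. Start from piecewise linear maps with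
supports `(0, 9)` and `(2, 11)`, both translation by `-2` on `[5, 8]`. Keep the second as `g`, and
obtain `f` from the first by twisting it on `(7, 8)` and `(5, 6)` with automorphisms `r₁, r₂`
supported in `(7, 8)`. The words `f⁻¹g` and `g⁻¹f⁻¹g²` fix `7` and `8` and act between them as `r₁`
and `r₂` (`word₁_middle`, `word₂_middle`). A countable left orderable group acts faithfully on `(7,
8)` (`exists_action_real`), so `r₁, r₂` may be the images of `h₁, h₂`: the middle interval sees
exactly `H`.

On the two outer sides the words satisfy the second presentation of `F`, with `a` played by the
second word to the left of `7` and by the first word to the right of `8` (`commutator_words_left`,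
`commutator_words_right`). These are the two coordinates of `P`, so a relation of `H`, being sent to
a relation of `P`, also holds on both sides. Hence the free group on the two words acts with the
same kernel as its map to `H`.

Whatever the twist, `f²g²` pushes the right end `9` of `supp f` past the left end `2` of `supp g`.
Conjugates of `g²` by its positive powers therefore commute with `f²`, which gives a homomorphism
from `F`. It is injective by `injective_of_test_points`: elements of `F` are fractions of positive
normal forms, and the exponents of a normal form can be read off from its action on suitable points.
-/

namespace SquareRootsOfF

open scoped commutatorElement

/-! ### Normal forms in Thompson's group -/

/-- The generator `A` of Thompson's group. -/
def genA : ThompsonF := PresentedGroup.of (0 : Fin 2)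

/-- The generator `B` of Thompson's group. -/
def genB : ThompsonF := PresentedGroup.of (1 : Fin 2)

/-- The generators `x₀ = AB` and `xₙ₊₁ = (AB)⁻ⁿ B (AB)ⁿ` of the infinite presentation of
Thompson's group. -/
def xgen : ℕ → ThompsonF
  | 0 => genA * genB
  | n + 1 => ((genA * genB) ^ n)⁻¹ * genB * (genA * genB) ^ n

theorem xgen_conj_zero (n : ℕ) : xgen (n + 1) * xgen 0 = xgen 0 * xgen (n + 2) := by
  simp only [xgen, pow_succ]
  group

theorem genA_eq : genA = xgen 0 * (xgen 1)⁻¹ := by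
  simp [xgen]

theorem commute_genA_xgen_two : Commute genA (xgen 2) := by
  have h : (PresentedGroup.mk relsAB) ⁅FreeGroup.of (0 : Fin 2),
      (FreeGroup.of 0 * FreeGroup.of 1)⁻¹ * FreeGroup.of 1 *
        (FreeGroup.of 0 * FreeGroup.of 1)⁆ = 1 :=
    PresentedGroup.one_of_mem (by simp [relsAB])
  rw [map_commutatorElement, commutatorElement_eq_one_iff_commute] at h
  simpa [xgen, genA, genB, PresentedGroup.of] using h

theorem commute_genA_xgen_three : Commute genA (xgen 3) := by
  have h : (PresentedGroup.mk relsAB) ⁅FreeGroup.of (0 : Fin 2),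
      ((FreeGroup.of 0 * FreeGroup.of 1) ^ 2)⁻¹ * FreeGroup.of 1 *
        (FreeGroup.of 0 * FreeGroup.of 1) ^ 2⁆ = 1 :=
    PresentedGroup.one_of_mem (by simp [relsAB])
  rw [map_commutatorElement, commutatorElement_eq_one_iff_commute] at h
  simpa [xgen, genA, genB, PresentedGroup.of] using h

/-- As `A = x₀x₁⁻¹`, commuting with `A` means being conjugated in the same way by `x₀` and by `x₁`;
conjugation by `x₀` raises the index. -/
theorem xgen_rel_one_of_commute {j : ℕ} (h : Commute genA (xgen (j + 1))) :
    xgen (j + 1) * xgen 1 = xgen 1 * xgen (j + 2) := by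
  have h0 := xgen_conj_zero j
  rw [genA_eq] at h
  have h' : xgen 0 * (xgen 1)⁻¹ * xgen (j + 1) = xgen (j + 1) * (xgen 0 * (xgen 1)⁻¹) := h
  have h1 : xgen (j + 2) = (xgen 0)⁻¹ * (xgen (j + 1) * xgen 0) := by rw [h0]; group
  rw [h1]
  calc xgen (j + 1) * xgen 1
      = xgen 1 * (xgen 0)⁻¹ * (xgen 0 * (xgen 1)⁻¹ * xgen (j + 1)) * xgen 1 := by group
    _ = _ := by rw [h']; group

theorem xgen_rel_shift {i j : ℕ} (h : xgen (j + 1) * xgen (i + 1) = xgen (i + 1) * xgen (j + 2)) :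
    xgen (j + 2) * xgen (i + 2) = xgen (i + 2) * xgen (j + 3) := by
  have e (n : ℕ) : xgen (n + 2) = (xgen 0)⁻¹ * (xgen (n + 1) * xgen 0) := by
    rw [xgen_conj_zero]; group
  rw [e j, e i, e (j + 1)]
  calc _ = (xgen 0)⁻¹ * (xgen (j + 1) * xgen (i + 1)) * xgen 0 := by group
    _ = _ := by rw [h]; group

theorem xgen_rel_consecutive (n : ℕ) :
    xgen (n + 2) * xgen (n + 1) = xgen (n + 1) * xgen (n + 3) := by
  induction n with
  | zero => exact xgen_rel_one_of_commute commute_genA_xgen_two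
  | succ n ih => exact xgen_rel_shift ih

/-- Two relators suffice because `xₙ₊₄` is the conjugate of `xₙ₊₃` by `xₙ₊₂`, so commutation with
two consecutive generators propagates to the next. -/
theorem commute_genA_xgen (n : ℕ) : Commute genA (xgen (n + 2)) ∧ Commute genA (xgen (n + 3)) := by
  induction n with
  | zero => exact ⟨commute_genA_xgen_two, commute_genA_xgen_three⟩
  | succ n ih =>
    refine ⟨ih.2, ?_⟩
    have h : xgen (n + 4) = (xgen (n + 2))⁻¹ * (xgen (n + 3) * xgen (n + 2)) := by
      rw [xgen_rel_consecutive (n + 1)]; group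
    rw [h]
    exact ih.1.inv_right.mul_right (ih.2.mul_right ih.1)

/-- The relations of the infinite presentation. -/
theorem xgen_rel {i j : ℕ} (h : i < j) : xgen j * xgen i = xgen i * xgen (j + 1) := by
  obtain ⟨d, rfl⟩ := Nat.exists_eq_add_of_lt h
  clear h
  rcases i with _ | i
  · simpa using xgen_conj_zero d
  induction i with
  | zero =>
    have := xgen_rel_one_of_commute (commute_genA_xgen d).1
    convert this using 2 <;> (congr 1; omega)
  | succ i ih =>
    have := xgen_rel_shift (i := i) (j := i + 1 + d) (by convert ih using 2)
    convert this using 2 <;> (congr 1; omega)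

theorem xgen_mul_pow {k j : ℕ} (h : k < j) (a : ℕ) :
    xgen j * xgen k ^ a = xgen k ^ a * xgen (j + a) := by
  induction a with
  | zero => simp
  | succ a ih =>
    rw [pow_succ, ← mul_assoc, ih, mul_assoc, xgen_rel (by omega), ← mul_assoc, add_assoc]

/-- `Pos k p` says that `p` has a positive normal form `x_k ^ a_k * x_{k+1} ^ a_{k+1} * ⋯`. -/
inductive Pos : ℕ → ThompsonF → Prop
  | one (k : ℕ) : Pos k 1
  | cons (k a : ℕ) (p : ThompsonF) : Pos (k + 1) p → Pos k (xgen k ^ a * p)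

theorem Pos.of_succ {k : ℕ} {p : ThompsonF} (h : Pos (k + 1) p) : Pos k p := by
  simpa using Pos.cons k 0 p h

theorem pos_xgen_add (k d : ℕ) : Pos k (xgen (k + d)) := by
  induction d generalizing k with
  | zero => simpa using Pos.cons k 1 1 (Pos.one _)
  | succ d ih =>
    have := (ih (k + 1)).of_succ
    rwa [show k + 1 + d = k + (d + 1) by omega] at this

theorem Pos.xgen_mul {k : ℕ} {p : ThompsonF} (h : Pos k p) {j : ℕ} (hj : k ≤ j) :
    Pos k (xgen j * p) := by
  induction h generalizing j with
  | one k =>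
    obtain ⟨d, rfl⟩ := Nat.exists_eq_add_of_le hj
    simpa using pos_xgen_add k d
  | cons k a p hp ih =>
    rcases hj.eq_or_lt with rfl | hj
    · rw [← mul_assoc, ← pow_succ']
      exact .cons _ _ _ hp
    · rw [← mul_assoc, xgen_mul_pow hj, mul_assoc]
      exact .cons _ _ _ (ih (by omega))

theorem Pos.xgen_pow_mul {k : ℕ} {p : ThompsonF} (h : Pos k p) {j : ℕ} (hj : k ≤ j) (a : ℕ) :
    Pos k (xgen j ^ a * p) := by
  induction a with
  | zero => simpa
  | succ a ih =>
    rw [pow_succ', mul_assoc]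
    exact ih.xgen_mul hj

theorem Pos.mul {k m : ℕ} {p q : ThompsonF} (hp : Pos k p) (hq : Pos m q) (hm : m ≤ k) :
    Pos m (p * q) := by
  induction hp with
  | one k => simpa
  | cons k a p hp ih =>
    rw [mul_assoc]
    exact (ih (by omega)).xgen_pow_mul hm a

theorem Pos.conj {k m : ℕ} {p : ThompsonF} (hp : Pos m p) (hk : k < m) :
    Pos (m + 1) ((xgen k)⁻¹ * p * xgen k) := by
  induction hp with
  | one m => simpa using Pos.one _
  | cons m a p hp ih =>
    have h : (xgen k)⁻¹ * xgen m * xgen k = xgen (m + 1) := by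
      rw [mul_assoc, xgen_rel hk]; group
    have h' : (xgen k)⁻¹ * (xgen m ^ a * p) * xgen k =
        xgen (m + 1) ^ a * ((xgen k)⁻¹ * p * xgen k) := by
      have := conj_pow (a := (xgen k)⁻¹) (b := xgen m) (i := a)
      rw [inv_inv, h] at this
      rw [this]
      group
    rw [h']
    exact .cons _ _ _ (ih (by omega))

/-- An Ore condition, used to move denominators to the right. For `k < j` the inverse `xⱼ⁻¹` passes
through `xₖᵃ` and becomes the inverse of `xⱼ₊ₐ`. For `j = k` it cancels a letter, or, when `a = 0`,
conjugation by `xₖ` keeps the rest positive. -/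
theorem Pos.exists_xgen_inv_mul {k : ℕ} {p : ThompsonF} (hp : Pos k p) {j : ℕ} (hj : k ≤ j) :
    ∃ r, Pos 0 r ∧ Pos k ((xgen j)⁻¹ * p * r) := by
  induction hp generalizing j with
  | one k =>
    refine ⟨xgen j, by simpa using pos_xgen_add 0 j, by simpa using Pos.one _⟩
  | cons k a p hp ih =>
    rcases hj.eq_or_lt with rfl | hj
    · rcases a with _ | a
      · refine ⟨xgen k, by simpa using pos_xgen_add 0 k, ?_⟩
        simpa using (hp.conj (Nat.lt_succ_self k)).of_succ.of_succ
      · refine ⟨1, .one _, ?_⟩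
        rw [pow_succ']
        convert Pos.cons k a p hp using 1
        group
    · obtain ⟨r, hr, h⟩ := ih (j := j + a) (by omega)
      refine ⟨r, hr, ?_⟩
      convert Pos.cons k a _ h using 1
      have := xgen_mul_pow hj a
      have e : (xgen j)⁻¹ * xgen k ^ a = xgen k ^ a * (xgen (j + a))⁻¹ := by
        rw [inv_mul_eq_iff_eq_mul, ← mul_assoc, this]; group
      calc _ = ((xgen j)⁻¹ * xgen k ^ a) * p * r := by group
        _ = _ := by rw [e]; group

theorem closure_genA_genB : Subgroup.closure {genA, genB} = (⊤ : Subgroup ThompsonF) := by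
  rw [← PresentedGroup.closure_range_of relsAB]
  congr 1
  ext y
  simp [genA, genB, Fin.exists_fin_two, eq_comm]

/-- Every element of Thompson's group is a fraction of positive elements. -/
theorem exists_pos_fraction (y : ThompsonF) : ∃ q, Pos 0 q ∧ Pos 0 (y * q) := by
  have hy : y ∈ Subgroup.closure {xgen 0, xgen 1} := by
    have hA : genA ∈ Subgroup.closure {xgen 0, xgen 1} := by
      rw [genA_eq]
      exact mul_mem (Subgroup.subset_closure (by simp))
        (inv_mem (Subgroup.subset_closure (by simp)))
    have hB : genB ∈ Subgroup.closure {xgen 0, xgen 1} :=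
      Subgroup.subset_closure (by simp [xgen])
    have : Subgroup.closure {genA, genB} ≤ Subgroup.closure {xgen 0, xgen 1} := by
      rw [Subgroup.closure_le]
      rintro z (rfl | rfl)
      exacts [hA, hB]
    rw [closure_genA_genB] at this
    exact this trivial
  have key : ∀ (j : ℕ) (z : ThompsonF), (∃ q, Pos 0 q ∧ Pos 0 (z * q)) →
      ∃ q, Pos 0 q ∧ Pos 0 ((xgen j)⁻¹ * z * q) := by
    rintro j z ⟨q, hq, hz⟩
    obtain ⟨r, hr, h⟩ := hz.exists_xgen_inv_mul (Nat.zero_le j)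
    exact ⟨q * r, hq.mul hr le_rfl, by simpa [mul_assoc] using h⟩
  have key' : ∀ (j : ℕ) (z : ThompsonF), (∃ q, Pos 0 q ∧ Pos 0 (z * q)) →
      ∃ q, Pos 0 q ∧ Pos 0 (xgen j * z * q) := by
    rintro j z ⟨q, hq, hz⟩
    exact ⟨q, hq, by simpa [mul_assoc] using hz.xgen_mul (Nat.zero_le j)⟩
  induction hy using Subgroup.closure_induction_left with
  | one => exact ⟨1, .one _, by simpa using Pos.one 0⟩
  | mul_left z hz w _ ih =>
    rcases hz with rfl | rfl
    exacts [key' 0 _ ih, key' 1 _ ih]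
  | inv_mul_cancel z hz w _ ih =>
    rcases hz with rfl | rfl
    exacts [key 0 _ ih, key 1 _ ih]

/-! ### A faithfulness criterion for actions of Thompson's group -/

section Faithful

variable {α : Type*} [LinearOrder α]

theorem pow_apply_lt_of_apply_lt {φ : α ≃o α} {y : α} (h : φ y < y) (n : ℕ) :
    (φ ^ (n + 1)) y < y := by
  induction n with
  | zero => simpa
  | succ n ih =>
    rw [pow_succ', RelIso.mul_apply]
    exact (φ.lt_iff_lt.2 ih).trans h

theorem pow_apply_inj {φ : α ≃o α} {y : α} (h : φ y < y) {a b : ℕ}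
    (hab : (φ ^ a) y = (φ ^ b) y) : a = b := by
  wlog hle : a ≤ b generalizing a b
  · exact (this hab.symm (le_of_not_ge hle)).symm
  obtain ⟨d, rfl⟩ := Nat.exists_eq_add_of_le hle
  rw [pow_add, RelIso.mul_apply, (φ ^ a).injective.eq_iff] at hab
  rcases d with _ | d
  · rfl
  · exact absurd hab.symm (pow_apply_lt_of_apply_lt h d).ne

variable {Θ : ThompsonF →* (α ≃o α)} {y : ℕ → α}

theorem Pos.map_apply (hfix : ∀ k j, k < j → Θ (xgen j) (y k) = y k) {k m : ℕ} {p : ThompsonF}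
    (hp : Pos m p) (hk : k < m) : Θ p (y k) = y k := by
  induction hp with
  | one => simp
  | cons m a p hp ih =>
    rw [map_mul, RelIso.mul_apply, ih (by omega), map_pow]
    induction a with
    | zero => simp
    | succ a iha => rw [pow_succ, RelIso.mul_apply, hfix _ _ hk, iha]

theorem Pos.eq_of_map_eq (hlt : ∀ k, Θ (xgen k) (y k) < y k)
    (hfix : ∀ k j, k < j → Θ (xgen j) (y k) = y k) {k : ℕ} {p q : ThompsonF}
    (hp : Pos k p) (hq : Pos k q) (h : Θ p = Θ q) : p = q := by
  -- The tails fix `y k`, so both sides move it by a power of `xₖ` alone; the orbit strictly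
  -- decreases, hence the exponents agree.
  have split : ∀ {k a b : ℕ} {p q : ThompsonF}, Pos (k + 1) p → Pos (k + 1) q →
      Θ (xgen k ^ a * p) = Θ (xgen k ^ b * q) → a = b ∧ Θ p = Θ q := by
    intro k a b p q hp hq h
    have hy := DFunLike.congr_fun h (y k)
    simp only [map_mul, map_pow, RelIso.mul_apply, hp.map_apply hfix k.lt_succ_self,
      hq.map_apply hfix k.lt_succ_self] at hy
    obtain rfl := pow_apply_inj (hlt k) hy
    exact ⟨rfl, by simpa using h⟩
  -- Normal forms may stop at different indices, so the case where one side has already ended is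
  -- treated separately.
  have triv : ∀ {k : ℕ} {q : ThompsonF}, Pos k q → Θ q = 1 → q = 1 := by
    intro k q hq h
    induction hq with
    | one => rfl
    | cons k a q hq ih =>
      obtain ⟨rfl, h1⟩ := split (b := 0) (q := 1) hq (.one _) (by simpa using h)
      simpa using ih (by simpa using h1)
  induction hp generalizing q with
  | one k => exact (triv hq (by simpa using h.symm)).symm
  | cons k a p hp ih =>
    cases hq with
    | one => exact triv (.cons _ _ _ hp) (by simpa using h)
    | cons _ b q hq =>
      obtain ⟨rfl, h1⟩ := split hp hq h
      rw [ih hq h1]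

/-- An action of Thompson's group is faithful as soon as there are points `y k` moved down by `x_k`
and fixed by all later generators. -/
theorem injective_of_test_points (hlt : ∀ k, Θ (xgen k) (y k) < y k)
    (hfix : ∀ k j, k < j → Θ (xgen j) (y k) = y k) : Function.Injective Θ := by
  rw [injective_iff_map_eq_one]
  intro z hz
  obtain ⟨q, hq, hzq⟩ := exists_pos_fraction z
  simpa using hzq.eq_of_map_eq hlt hfix hq (by simp [hz])

end Faithful

/-! ### Extending order automorphisms of `ℚ` to `ℝ` -/

/-- The monotone extension to `ℝ` of a map of `ℚ`. -/
noncomputable def monoExt (σ : ℚ → ℚ) (x : ℝ) : ℝ :=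
  sSup ((fun q : ℚ => (σ q : ℝ)) '' {q | (q : ℝ) ≤ x})

theorem monoExt_bddAbove {σ : ℚ → ℚ} (hσ : Monotone σ) (x : ℝ) :
    BddAbove ((fun q : ℚ => (σ q : ℝ)) '' {q | (q : ℝ) ≤ x}) := by
  obtain ⟨r, hr⟩ := exists_rat_gt x
  refine ⟨σ r, ?_⟩
  rintro _ ⟨q, hq, rfl⟩
  have : q ≤ r := by exact_mod_cast (hq.trans hr.le : (q : ℝ) ≤ r)
  exact Rat.cast_le.2 (hσ this)

theorem monoExt_mono {σ : ℚ → ℚ} (hσ : Monotone σ) : Monotone (monoExt σ) := by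
  intro x y hxy
  obtain ⟨r, hr⟩ := exists_rat_lt x
  exact csSup_le_csSup (monoExt_bddAbove hσ y) ⟨_, r, hr.le, rfl⟩
    (Set.image_mono fun q (hq : (q : ℝ) ≤ x) => hq.trans hxy)

theorem monoExt_ratCast {σ : ℚ → ℚ} (hσ : Monotone σ) (q : ℚ) : monoExt σ q = σ q := by
  refine IsGreatest.csSup_eq ⟨⟨q, le_refl (q : ℝ), rfl⟩, ?_⟩
  rintro _ ⟨r, hr, rfl⟩
  have : r ≤ q := by exact_mod_cast hr
  exact Rat.cast_le.2 (hσ this)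

/-- A gap between the two values would contain a rational `σ q`, and monotonicity would put `q` on
both sides of `x`. This uniqueness makes the extension multiplicative. -/
theorem monotone_ext_rat {φ ψ : ℝ → ℝ} (hφ : Monotone φ) (hψ : Monotone ψ) {σ : ℚ → ℚ}
    (hσ : Function.Surjective σ) (h₁ : ∀ q : ℚ, φ q = σ q) (h₂ : ∀ q : ℚ, ψ q = σ q) :
    φ = ψ := by
  have key : ∀ {φ ψ : ℝ → ℝ}, Monotone φ → Monotone ψ → (∀ q : ℚ, φ q = σ q) →
      (∀ q : ℚ, ψ q = σ q) → ∀ x, ψ x ≤ φ x := by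
    intro φ ψ hφ hψ h₁ h₂ x
    by_contra! hlt
    obtain ⟨r, hr₁, hr₂⟩ := exists_rat_btwn hlt
    obtain ⟨q, rfl⟩ := hσ r
    rw [← h₁] at hr₁
    rw [← h₂] at hr₂
    exact lt_asymm (hφ.reflect_lt hr₁) (hψ.reflect_lt hr₂)
  exact funext fun x => le_antisymm (key hψ hφ h₂ h₁ x) (key hφ hψ h₁ h₂ x)

theorem monoExt_comp (σ τ : ℚ ≃o ℚ) (x : ℝ) : monoExt σ (monoExt τ x) =
    monoExt (σ * τ : ℚ ≃o ℚ) x := by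
  refine congr_fun (monotone_ext_rat (φ := fun x => monoExt σ (monoExt τ x))
    ((monoExt_mono σ.monotone).comp (monoExt_mono τ.monotone))
    (monoExt_mono (σ * τ).monotone) (σ * τ).surjective (fun q => ?_) fun q => ?_) x
  · rw [monoExt_ratCast τ.monotone, monoExt_ratCast σ.monotone, RelIso.mul_apply]
  · exact monoExt_ratCast (σ * τ).monotone q

theorem monoExt_one (x : ℝ) : monoExt (1 : ℚ ≃o ℚ) x = x :=
  congr_fun (monotone_ext_rat (ψ := id) (monoExt_mono (1 : ℚ ≃o ℚ).monotone) monotone_id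
    (1 : ℚ ≃o ℚ).surjective (monoExt_ratCast (1 : ℚ ≃o ℚ).monotone) fun _ => rfl) x

/-- The extension of order automorphisms of `ℚ` to order automorphisms of `ℝ`. -/
noncomputable def extendReal : (ℚ ≃o ℚ) →* (ℝ ≃o ℝ) where
  toFun σ := Equiv.toOrderIso
    { toFun := monoExt σ
      invFun := monoExt (σ⁻¹ : ℚ ≃o ℚ)
      left_inv := fun x => by rw [monoExt_comp, inv_mul_cancel, monoExt_one]
      right_inv := fun x => by rw [monoExt_comp, mul_inv_cancel, monoExt_one] }
    (monoExt_mono σ.monotone) (monoExt_mono (σ⁻¹ : ℚ ≃o ℚ).monotone)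
  map_one' := by ext x; exact monoExt_one x
  map_mul' σ τ := by ext x; exact (monoExt_comp σ τ x).symm

theorem extendReal_ratCast (σ : ℚ ≃o ℚ) (q : ℚ) : extendReal σ q = σ q :=
  monoExt_ratCast σ.monotone q

theorem extendReal_injective : Function.Injective extendReal := by
  intro σ τ h
  ext q
  have := DFunLike.congr_fun h (q : ℝ)
  rw [extendReal_ratCast, extendReal_ratCast] at this
  exact_mod_cast this

/-- If `σ` is the identity off `(a, b)`, then so is its extension. -/
theorem extendReal_apply_of_notMem {σ : ℚ ≃o ℚ} {a b : ℚ}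
    (h : ∀ q, q ∉ Set.Ioo a b → σ q = q) {x : ℝ} (hx : x ∉ Set.Ioo (a : ℝ) b) :
    extendReal σ x = x := by
  rw [Set.mem_Ioo, not_and_or, not_lt, not_lt] at hx
  have fixes (r : ℚ) (hr : r ≤ a ∨ b ≤ r) : extendReal σ r = r := by
    rw [extendReal_ratCast, h]
    rw [Set.mem_Ioo, not_and_or, not_lt, not_lt]
    exact hr
  rcases hx with hx | hx
  · refine le_antisymm (le_of_not_gt fun hlt => ?_) (le_of_not_gt fun hlt => ?_)
    -- The separating rational must also lie below `a` in order to be fixed; `x = a` is excluded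
    -- because `a` itself is fixed.
    · obtain ⟨r, hr₁, hr₂⟩ := exists_rat_btwn (show x < min (extendReal σ x) a from
        lt_min hlt <| hx.lt_of_ne fun e => by
          rw [e, fixes a (.inl le_rfl)] at hlt; exact lt_irrefl _ hlt)
      have h1 : extendReal σ x < extendReal σ r := (extendReal σ).lt_iff_lt.2 hr₁
      rw [fixes r (.inl (by exact_mod_cast (hr₂.trans_le (min_le_right _ _)).le))] at h1
      exact lt_asymm h1 (hr₂.trans_le (min_le_left _ _))
    · obtain ⟨r, hr₁, hr₂⟩ := exists_rat_btwn hlt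
      have h1 : extendReal σ r < extendReal σ x := (extendReal σ).lt_iff_lt.2 hr₂
      rw [fixes r (.inl (by exact_mod_cast (hr₂.trans_le hx).le))] at h1
      exact lt_asymm h1 hr₁
  · refine le_antisymm (le_of_not_gt fun hlt => ?_) (le_of_not_gt fun hlt => ?_)
    · obtain ⟨r, hr₁, hr₂⟩ := exists_rat_btwn hlt
      have h1 : extendReal σ x < extendReal σ r := (extendReal σ).lt_iff_lt.2 hr₁
      rw [fixes r (.inr (by exact_mod_cast (hx.trans_lt hr₁).le))] at h1
      exact lt_asymm h1 hr₂
    · obtain ⟨r, hr₁, hr₂⟩ := exists_rat_btwn (show max (extendReal σ x) b < x from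
        max_lt hlt <| hx.lt_of_ne fun e => by
          rw [← e, fixes b (.inr le_rfl)] at hlt; exact lt_irrefl _ hlt)
      have h1 : extendReal σ r < extendReal σ x := (extendReal σ).lt_iff_lt.2 hr₂
      rw [fixes r (.inr (by exact_mod_cast ((le_max_right _ _).trans_lt hr₁).le))] at h1
      exact lt_asymm h1 ((le_max_left _ _).trans_lt hr₁)

/-! ### Dynamical realization of a countable left orderable group -/

theorem strictMono_ofSubtype_Ioo {a b : ℚ} {σ : Equiv.Perm (Set.Ioo a b)} (hσ : StrictMono σ) :
    StrictMono (Equiv.Perm.ofSubtype σ) := by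
  intro x y hxy
  by_cases hx : x ∈ Set.Ioo a b <;> by_cases hy : y ∈ Set.Ioo a b
  · rw [Equiv.Perm.ofSubtype_apply_of_mem σ hx, Equiv.Perm.ofSubtype_apply_of_mem σ hy]
    exact hσ hxy
  · rw [Equiv.Perm.ofSubtype_apply_of_mem σ hx, Equiv.Perm.ofSubtype_apply_of_not_mem σ hy]
    exact (σ ⟨x, hx⟩).2.2.trans_le (le_of_not_gt fun h => hy ⟨hx.1.trans hxy, h⟩)
  · rw [Equiv.Perm.ofSubtype_apply_of_not_mem σ hx, Equiv.Perm.ofSubtype_apply_of_mem σ hy]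
    exact (le_of_not_gt fun h => hx ⟨h, hxy.trans hy.2⟩).trans_lt (σ ⟨y, hy⟩).2.1
  · rwa [Equiv.Perm.ofSubtype_apply_of_not_mem σ hx, Equiv.Perm.ofSubtype_apply_of_not_mem σ hy]

/-- Left multiplication on the first coordinate preserves the lexicographic order on `H × ℚ`. The
factor `ℚ` makes this order dense without endpoints even when `H` is discrete or trivial, so
Cantor's theorem identifies it with the rationals of `(a, b)`. -/
theorem exists_action_rat {H : Type*} [Group H] [Countable H] (hlo : LeftOrderable H) {a b : ℚ}
    (hab : a < b) : ∃ ρ : H →* (ℚ ≃o ℚ), Function.Injective ρ ∧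
      ∀ h q, q ∉ Set.Ioo a b → ρ h q = q := by
  obtain ⟨_, hmul⟩ := hlo
  have hmul' : ∀ h : H, StrictMono (h * ·) := fun h => Monotone.strictMono_of_injective
    (fun x y hxy => hmul x y h hxy) (mul_right_injective h)
  have : Countable (H ×ₗ ℚ) := inferInstanceAs (Countable (H × ℚ))
  have : Nonempty (Set.Ioo a b) := (Set.nonempty_Ioo.2 hab).to_subtype
  obtain ⟨j⟩ := Order.iso_of_countable_dense (H ×ₗ ℚ) (Set.Ioo a b)
  let shift : H →* Equiv.Perm (H ×ₗ ℚ) :=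
    { toFun := fun h => ofLex.trans (((Equiv.mulLeft h).prodCongr (Equiv.refl ℚ)).trans toLex)
      map_one' := by ext x : 1; simp
      map_mul' := fun h h' => by ext x : 1; simp [Prod.map] }
  have shift_apply : ∀ h x, shift h x = toLex (h * (ofLex x).1, (ofLex x).2) := fun _ _ => rfl
  have shift_mono : ∀ h, StrictMono (shift h) := by
    intro h x y hxy
    rw [Prod.Lex.lt_iff] at hxy
    rw [shift_apply, shift_apply, Prod.Lex.toLex_lt_toLex]
    exact hxy.imp (fun h' => hmul' h h') (fun h' => ⟨by rw [h'.1], h'.2⟩)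
  let θ : H →* Equiv.Perm ℚ :=
    Equiv.Perm.ofSubtype.comp ((Equiv.permCongrHom j.toEquiv).toMonoidHom.comp shift)
  have θ_mono : ∀ h, StrictMono (θ h) := fun h => strictMono_ofSubtype_Ioo
    (σ := j.toEquiv.permCongr (shift h))
    (j.strictMono.comp ((shift_mono h).comp j.symm.strictMono))
  refine ⟨{ toFun := fun h => ⟨θ h, (θ_mono h).le_iff_le⟩
            map_one' := by ext q; change θ 1 q = q; simp
            map_mul' := fun h h' => by
              ext q; change θ (h * h') q = θ h (θ h' q); simp }, ?_, ?_⟩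
  · intro h h' e
    have e' : θ h = θ h' := Equiv.ext fun q => DFunLike.congr_fun e q
    have e1 : shift h = shift h' := (Equiv.permCongrHom j.toEquiv).injective
      (Equiv.Perm.ofSubtype_injective e')
    have e2 := congr_arg (fun σ => (ofLex (σ (toLex ((1 : H), (0 : ℚ))))).1) e1
    simpa [shift_apply] using e2
  · intro h q hq
    exact Equiv.Perm.ofSubtype_apply_of_not_mem _ hq

theorem exists_action_real {H : Type*} [Group H] [Countable H] (hlo : LeftOrderable H) {a b : ℚ}
    (hab : a < b) : ∃ ρ : H →* (ℝ ≃o ℝ), Function.Injective ρ ∧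
      ∀ h (x : ℝ), x ∉ Set.Ioo (a : ℝ) b → ρ h x = x := by
  obtain ⟨ρ, hρ, hfix⟩ := exists_action_rat hlo hab
  exact ⟨extendReal.comp ρ, extendReal_injective.comp hρ,
    fun h x hx => extendReal_apply_of_notMem (hfix h) hx⟩

/-! ### Order automorphisms commuting on an invariant set -/

theorem commutator_apply_of_disjoint {α : Type*} [LE α] {u v : α ≃o α} {D : Set α}
    (hu : ∀ x ∈ D, u x ∈ D) (hu' : ∀ x ∈ D, u⁻¹ x ∈ D) (hv : ∀ x ∈ D, v x ∈ D)
    (hv' : ∀ x ∈ D, v⁻¹ x ∈ D) (h : ∀ x ∈ D, u x = x ∨ v x = x) {x : α} (hx : x ∈ D) :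
    ⁅u, v⁆ x = x := by
  have comm : ∀ {u v : α ≃o α}, (∀ x ∈ D, v x ∈ D) → (∀ x ∈ D, u x = x ∨ v x = x) →
      ∀ x ∈ D, u x = x → u (v x) = v (u x) := by
    intro u v hv h x hx hux
    rw [hux]
    rcases h _ (hv x hx) with h' | h'
    · exact h'
    · rw [v.injective h', hux]
  have key : ∀ x ∈ D, u (v x) = v (u x) := by
    intro x hx
    rcases h x hx with h' | h'
    · exact comm hv h x hx h'
    · exact (comm hu (fun y hy => (h y hy).symm) x hx h').symm
  rw [commutatorElement_def, RelIso.mul_apply, RelIso.mul_apply, RelIso.mul_apply,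
    key _ (hu' _ (hv' _ hx)), RelIso.apply_inv_self, RelIso.apply_inv_self]

/-! ### The piecewise linear maps -/

/-- A piecewise linear function with support `(0, 9)` which is `x ↦ x - 2` on `[4, 8]`. -/
noncomputable def plFFun (x : ℝ) : ℝ := min x (max (x / 2) (max (x - 2) (3 * x - 18)))

/-- A piecewise linear function with support `(2, 11)` which is `x ↦ x - 2` on `[5, 9]`. -/
noncomputable def plGFun (x : ℝ) : ℝ := min x (max ((x + 4) / 3) (max (x - 2) (2 * x - 11)))

theorem plFFun_of_nonpos {x : ℝ} (h : x ≤ 0) : plFFun x = x := by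
  unfold plFFun; rw [min_def, max_def, max_def]; split_ifs <;> linarith

theorem plFFun_of_ge {x : ℝ} (h : 9 ≤ x) : plFFun x = x := by
  unfold plFFun; rw [min_def, max_def, max_def]; split_ifs <;> linarith

theorem plFFun_lt {x : ℝ} (h₀ : 0 < x) (h₁ : x < 9) : plFFun x < x := by
  unfold plFFun; rw [min_def, max_def, max_def]; split_ifs <;> linarith

theorem plFFun_sub_two {x : ℝ} (h₀ : 4 ≤ x) (h₁ : x ≤ 8) : plFFun x = x - 2 := by
  unfold plFFun; rw [min_def, max_def, max_def]; split_ifs <;> linarith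

theorem plFFun_half {x : ℝ} (h₀ : 0 ≤ x) (h₁ : x ≤ 4) : plFFun x = x / 2 := by
  unfold plFFun; rw [min_def, max_def, max_def]; split_ifs <;> linarith

theorem plFFun_right {x : ℝ} (h₀ : 8 ≤ x) (h₁ : x ≤ 9) : plFFun x = 3 * x - 18 := by
  unfold plFFun; rw [min_def, max_def, max_def]; split_ifs <;> linarith

theorem plGFun_of_le {x : ℝ} (h : x ≤ 2) : plGFun x = x := by
  unfold plGFun; rw [min_def, max_def, max_def]; split_ifs <;> linarith

theorem plGFun_of_ge {x : ℝ} (h : 11 ≤ x) : plGFun x = x := by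
  unfold plGFun; rw [min_def, max_def, max_def]; split_ifs <;> linarith

theorem plGFun_lt {x : ℝ} (h₀ : 2 < x) (h₁ : x < 11) : plGFun x < x := by
  unfold plGFun; rw [min_def, max_def, max_def]; split_ifs <;> linarith

theorem plGFun_sub_two {x : ℝ} (h₀ : 5 ≤ x) (h₁ : x ≤ 9) : plGFun x = x - 2 := by
  unfold plGFun; rw [min_def, max_def, max_def]; split_ifs <;> linarith

theorem plGFun_left {x : ℝ} (h₀ : 2 ≤ x) (h₁ : x ≤ 5) : plGFun x = (x + 4) / 3 := by
  unfold plGFun; rw [min_def, max_def, max_def]; split_ifs <;> linarith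

theorem plGFun_right {x : ℝ} (h₀ : 9 ≤ x) (h₁ : x ≤ 11) : plGFun x = 2 * x - 11 := by
  unfold plGFun; rw [min_def, max_def, max_def]; split_ifs <;> linarith

theorem plFFun_strictMono : StrictMono plFFun := by
  intro x y h
  unfold plFFun
  exact min_lt_min h (max_lt_max (by linarith) (max_lt_max (by linarith) (by linarith)))

theorem plGFun_strictMono : StrictMono plGFun := by
  intro x y h
  unfold plGFun
  exact min_lt_min h (max_lt_max (by linarith) (max_lt_max (by linarith) (by linarith)))

theorem plFFun_surjective : Function.Surjective plFFun := by
  intro y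
  rcases le_total y 0 with h₀ | h₀
  · exact ⟨y, plFFun_of_nonpos h₀⟩
  rcases le_total y 2 with h₁ | h₁
  · exact ⟨2 * y, by rw [plFFun_half] <;> linarith⟩
  rcases le_total y 6 with h₂ | h₂
  · exact ⟨y + 2, by rw [plFFun_sub_two] <;> linarith⟩
  rcases le_total y 9 with h₃ | h₃
  · exact ⟨(y + 18) / 3, by rw [plFFun_right] <;> linarith⟩
  · exact ⟨y, plFFun_of_ge h₃⟩

theorem plGFun_surjective : Function.Surjective plGFun := by
  intro y
  rcases le_total y 2 with h₀ | h₀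
  · exact ⟨y, plGFun_of_le h₀⟩
  rcases le_total y 3 with h₁ | h₁
  · exact ⟨3 * y - 4, by rw [plGFun_left] <;> linarith⟩
  rcases le_total y 7 with h₂ | h₂
  · exact ⟨y + 2, by rw [plGFun_sub_two] <;> linarith⟩
  rcases le_total y 11 with h₃ | h₃
  · exact ⟨(y + 11) / 2, by rw [plGFun_right] <;> linarith⟩
  · exact ⟨y, plGFun_of_ge h₃⟩

/-- The order automorphism of `ℝ` given by `plFFun`. -/
noncomputable def plF : ℝ ≃o ℝ := plFFun_strictMono.orderIsoOfSurjective _ plFFun_surjective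

/-- The order automorphism of `ℝ` given by `plGFun`. -/
noncomputable def plG : ℝ ≃o ℝ := plGFun_strictMono.orderIsoOfSurjective _ plGFun_surjective

theorem plF_of_nonpos {x : ℝ} (h : x ≤ 0) : plF x = x :=
  plFFun_of_nonpos h

theorem plF_of_ge {x : ℝ} (h : 9 ≤ x) : plF x = x :=
  plFFun_of_ge h

theorem plF_lt {x : ℝ} (h₀ : 0 < x) (h₁ : x < 9) : plF x < x :=
  plFFun_lt h₀ h₁

theorem plF_sub_two {x : ℝ} (h₀ : 4 ≤ x) (h₁ : x ≤ 8) : plF x = x - 2 :=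
  plFFun_sub_two h₀ h₁

theorem plF_half {x : ℝ} (h₀ : 0 ≤ x) (h₁ : x ≤ 4) : plF x = x / 2 :=
  plFFun_half h₀ h₁

theorem plG_of_le {x : ℝ} (h : x ≤ 2) : plG x = x :=
  plGFun_of_le h

theorem plG_of_ge {x : ℝ} (h : 11 ≤ x) : plG x = x :=
  plGFun_of_ge h

theorem plG_lt {x : ℝ} (h₀ : 2 < x) (h₁ : x < 11) : plG x < x :=
  plGFun_lt h₀ h₁

theorem plG_sub_two {x : ℝ} (h₀ : 5 ≤ x) (h₁ : x ≤ 9) : plG x = x - 2 :=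
  plGFun_sub_two h₀ h₁

theorem plG_right {x : ℝ} (h₀ : 9 ≤ x) (h₁ : x ≤ 11) : plG x = 2 * x - 11 :=
  plGFun_right h₀ h₁

/-! ### The generators of the square root -/

/-- `SuppMid r` says that `r` is the identity outside `(7, 8)`. -/
def SuppMid (r : ℝ ≃o ℝ) : Prop := ∀ x, x ∉ Set.Ioo (7 : ℝ) 8 → r x = x

/-- The order automorphism of `ℝ` which differs from `plF` by `r₁` on `(7, 8)` and by a conjugate
of `r₂` on `(5, 6)`. -/
noncomputable def twistF (r₁ r₂ : ℝ ≃o ℝ) : ℝ ≃o ℝ := plF * r₁⁻¹ * (plG * r₂⁻¹ * plG⁻¹)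

theorem inv_apply_of_apply_eq {α : Type*} [LE α] {φ : α ≃o α} {x y : α} (h : φ x = y) :
    φ⁻¹ y = x := by
  rw [← h, RelIso.inv_apply_self]

section Twist

variable {r₁ r₂ : ℝ ≃o ℝ}

theorem twistF_apply (x : ℝ) : twistF r₁ r₂ x = plF (r₁⁻¹ (plG (r₂⁻¹ (plG⁻¹ x)))) := rfl

/-- `plG` translates `(7, 8)` onto `(5, 6)`, so the two twists in `twistF` have disjoint supports
and do not interfere. -/
theorem conj_plG_apply (h₂ : SuppMid r₂) {x : ℝ}
    (hx : x ∉ Set.Ioo (5 : ℝ) 6) : plG (r₂⁻¹ (plG⁻¹ x)) = x := by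
  have hz : plG⁻¹ x ∉ Set.Ioo (7 : ℝ) 8 := by
    rintro ⟨ha, hb⟩
    have := plG_sub_two (x := plG⁻¹ x) (by linarith) (by linarith)
    rw [RelIso.apply_inv_self] at this
    exact hx ⟨by linarith, by linarith⟩
  rw [inv_apply_of_apply_eq (h₂ _ hz), RelIso.apply_inv_self]

theorem conj_plG_mem (h₂ : SuppMid r₂) {x : ℝ}
    (hx : x ∈ Set.Ioo (5 : ℝ) 6) : plG (r₂⁻¹ (plG⁻¹ x)) ∈ Set.Ioo (5 : ℝ) 6 := by
  by_contra h
  have h5 := conj_plG_apply h₂ (x := 5) (by norm_num)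
  have h6 := conj_plG_apply h₂ (x := 6) (by norm_num)
  refine h ⟨?_, ?_⟩
  · rw [← h5]; simpa using hx.1
  · rw [← h6]; simpa using hx.2

theorem inv_mem_Ioo {r : ℝ ≃o ℝ} {a b : ℝ} (h : ∀ x, x ∉ Set.Ioo a b → r x = x) {x : ℝ}
    (hx : x ∈ Set.Ioo a b) : r⁻¹ x ∈ Set.Ioo a b := by
  by_contra h'
  have := h _ h'
  rw [RelIso.apply_inv_self] at this
  exact h' (this ▸ hx)

theorem twistF_eq_plF (h₁ : SuppMid r₁) (h₂ : SuppMid r₂) {x : ℝ}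
    (hx : x ∉ Set.Ioo (5 : ℝ) 6) (hx' : x ∉ Set.Ioo (7 : ℝ) 8) : twistF r₁ r₂ x = plF x := by
  rw [twistF_apply, conj_plG_apply h₂ hx, inv_apply_of_apply_eq (h₁ _ hx')]

theorem twistF_lt (h₁ : SuppMid r₁) (h₂ : SuppMid r₂) {x : ℝ} (h₀ : 0 < x) (h₉ : x < 9) :
    twistF r₁ r₂ x < x := by
  by_cases hx : x ∈ Set.Ioo (5 : ℝ) 6
  · obtain ⟨ha, hb⟩ := conj_plG_mem h₂ hx
    rw [twistF_apply, inv_apply_of_apply_eq (h₁ _ fun h => by linarith [h.1]),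
      plF_sub_two (by linarith) (by linarith)]
    linarith [hx.1]
  by_cases hx' : x ∈ Set.Ioo (7 : ℝ) 8
  · obtain ⟨ha, hb⟩ := inv_mem_Ioo h₁ hx'
    rw [twistF_apply, conj_plG_apply h₂ hx, plF_sub_two (by linarith) (by linarith)]
    linarith [hx'.1]
  rw [twistF_eq_plF h₁ h₂ hx hx']
  exact plF_lt h₀ h₉

theorem twistF_of_nonpos (h₁ : SuppMid r₁) (h₂ : SuppMid r₂) {x : ℝ} (h : x ≤ 0) :
    twistF r₁ r₂ x = x := by
  rw [twistF_eq_plF h₁ h₂ (fun h => by linarith [h.1]) (fun h => by linarith [h.1]),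
    plF_of_nonpos h]

theorem twistF_of_ge (h₁ : SuppMid r₁) (h₂ : SuppMid r₂) {x : ℝ} (h : 9 ≤ x) :
    twistF r₁ r₂ x = x := by
  rw [twistF_eq_plF h₁ h₂ (fun h => by linarith [h.2]) (fun h => by linarith [h.2]),
    plF_of_ge h]

theorem twistF_half (h₁ : SuppMid r₁) (h₂ : SuppMid r₂) {x : ℝ} (h₀ : 0 ≤ x) (h₄ : x ≤ 4) :
    twistF r₁ r₂ x = x / 2 := by
  rw [twistF_eq_plF h₁ h₂ (fun h => by linarith [h.1]) (fun h => by linarith [h.1]),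
    plF_half h₀ h₄]

theorem twistF_sub_two (h₁ : SuppMid r₁) (h₂ : SuppMid r₂) {x : ℝ}
    (hx : x ∈ Set.Icc (4 : ℝ) 5 ∨ x ∈ Set.Icc (6 : ℝ) 7) : twistF r₁ r₂ x = x - 2 := by
  rcases hx with ⟨ha, hb⟩ | ⟨ha, hb⟩
  all_goals
    rw [twistF_eq_plF h₁ h₂ (fun h => by linarith [h.1, h.2]) (fun h => by linarith [h.1, h.2]),
      plF_sub_two (by linarith) (by linarith)]

/-! ### The words `f⁻¹g` and `g⁻¹f⁻¹g²` -/

/-- The word `f⁻¹ g`. -/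
noncomputable def word₁ (r₁ r₂ : ℝ ≃o ℝ) : ℝ ≃o ℝ := (twistF r₁ r₂)⁻¹ * plG

/-- The word `g⁻¹ f⁻¹ g²`. -/
noncomputable def word₂ (r₁ r₂ : ℝ ≃o ℝ) : ℝ ≃o ℝ := plG⁻¹ * word₁ r₁ r₂ * plG

theorem word₁_apply_eq {x y : ℝ} (h : twistF r₁ r₂ y = plG x) : word₁ r₁ r₂ x = y :=
  inv_apply_of_apply_eq h

theorem word₂_apply_eq {x y : ℝ} (h : twistF r₁ r₂ (plG y) = plG (plG x)) :
    word₂ r₁ r₂ x = y :=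
  inv_apply_of_apply_eq (word₁_apply_eq h).symm

theorem apply_mem_Icc {r : ℝ ≃o ℝ} {a b : ℝ} (h : ∀ x, x ∉ Set.Ioo a b → r x = x) {x : ℝ}
    (hx : x ∈ Set.Icc a b) : r x ∈ Set.Icc a b := by
  have ha := h a (by simp)
  have hb := h b (by simp)
  exact ⟨by rw [← ha]; exact r.monotone hx.1, by rw [← hb]; exact r.monotone hx.2⟩

/-- On `[7, 8]` the translations in `f` and `g` cancel, leaving the inverse of the twist `r₁⁻¹`. -/
theorem word₁_middle (h₁ : SuppMid r₁) (h₂ : SuppMid r₂) {x : ℝ}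
    (hx : x ∈ Set.Icc (7 : ℝ) 8) : word₁ r₁ r₂ x = r₁ x := by
  apply word₁_apply_eq
  obtain ⟨ha, hb⟩ := apply_mem_Icc h₁ hx
  rw [twistF_apply, conj_plG_apply h₂ (fun h => by linarith [h.2]), RelIso.inv_apply_self,
    plF_sub_two (by linarith [hx.1]) hx.2, plG_sub_two (by linarith [hx.1]) (by linarith [hx.2])]

/-- Here `g²` lands in `[3, 4]` and `f⁻¹` returns through `[5, 6]`, where the twist is `g r₂⁻¹ g⁻¹`;
the final `g⁻¹` undoes the conjugation. -/
theorem word₂_middle (h₁ : SuppMid r₁) {x : ℝ}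
    (hx : x ∈ Set.Icc (7 : ℝ) 8) : word₂ r₁ r₂ x = r₂ x := by
  apply word₂_apply_eq
  obtain ⟨ha, hb⟩ := hx
  rw [twistF_apply, RelIso.inv_apply_self, RelIso.inv_apply_self,
    plG_sub_two (x := x) (by linarith) (by linarith),
    inv_apply_of_apply_eq (h₁ (x - 2) (fun h => by linarith [h.1])),
    plF_sub_two (by linarith) (by linarith), plG_sub_two (by linarith) (by linarith)]

theorem word₁_of_mem_Icc (h₁ : SuppMid r₁) (h₂ : SuppMid r₂) {x : ℝ}
    (hx : x ∈ Set.Icc (6 : ℝ) 7) : word₁ r₁ r₂ x = x :=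
  word₁_apply_eq <| by
    rw [twistF_sub_two h₁ h₂ (.inr hx), plG_sub_two (by linarith [hx.1]) (by linarith [hx.2])]

theorem word₂_of_mem_Icc (h₁ : SuppMid r₁) (h₂ : SuppMid r₂) {x : ℝ}
    (hx : x ∈ Set.Icc (8 : ℝ) 9) : word₂ r₁ r₂ x = x := by
  apply word₂_apply_eq
  obtain ⟨ha, hb⟩ := hx
  rw [plG_sub_two (x := x) (by linarith) hb,
    twistF_sub_two h₁ h₂ (.inr ⟨by linarith, by linarith⟩),
    plG_sub_two (by linarith) (by linarith)]

theorem word₁_seven (h₁ : SuppMid r₁) (h₂ : SuppMid r₂) : word₁ r₁ r₂ 7 = 7 :=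
  word₁_of_mem_Icc h₁ h₂ (by norm_num)

theorem word₁_eight (h₁ : SuppMid r₁) (h₂ : SuppMid r₂) : word₁ r₁ r₂ 8 = 8 := by
  rw [word₁_middle h₁ h₂ (by norm_num), h₁ _ (by simp)]

theorem word₂_seven (h₁ : SuppMid r₁) (h₂ : SuppMid r₂) : word₂ r₁ r₂ 7 = 7 := by
  rw [word₂_middle h₁ (by norm_num), h₂ _ (by simp)]

theorem word₂_eight (h₁ : SuppMid r₁) (h₂ : SuppMid r₂) : word₂ r₁ r₂ 8 = 8 :=
  word₂_of_mem_Icc h₁ h₂ (by norm_num)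

theorem word₂_two (h₁ : SuppMid r₁) (h₂ : SuppMid r₂) : word₂ r₁ r₂ 2 = 6 := by
  apply word₂_apply_eq
  rw [plG_of_le le_rfl, plG_of_le le_rfl, plG_sub_two (by norm_num) (by norm_num),
    twistF_half h₁ h₂ (by norm_num) (by norm_num)]
  norm_num

theorem word₁_ten (h₁ : SuppMid r₁) (h₂ : SuppMid r₂) : word₁ r₁ r₂ 10 = 9 := by
  apply word₁_apply_eq
  rw [twistF_of_ge h₁ h₂ le_rfl, plG_right (by norm_num) (by norm_num)]
  norm_num

/-- Left of `2` the map `g` is trivial and `f` preserves this region, so both words undo `f` there.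
-/
theorem word₂_mul_word₁_inv_apply (h₁ : SuppMid r₁) (h₂ : SuppMid r₂) {y : ℝ} (hy : y ≤ 2) :
    (word₂ r₁ r₂ * (word₁ r₁ r₂)⁻¹) y = y := by
  have hf : twistF r₁ r₂ y ≤ 2 := by
    rcases le_total y 0 with h | h
    · rwa [twistF_of_nonpos h₁ h₂ h]
    · rw [twistF_half h₁ h₂ h (by linarith)]; linarith
  have e : (word₁ r₁ r₂)⁻¹ y = twistF r₁ r₂ y :=
    inv_apply_of_apply_eq (word₁_apply_eq (by rw [plG_of_le hf]))
  rw [RelIso.mul_apply, e]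
  exact word₂_apply_eq (by rw [plG_of_le hy, plG_of_le hf, plG_of_le hf])

/-- Since `g` sends `10` to `9`, every value of `f` involved is taken to the right of its support,
and both inverse words reduce to `g⁻¹`. -/
theorem word₁_mul_word₂_inv_apply (h₁ : SuppMid r₁) (h₂ : SuppMid r₂) {y : ℝ} (hy : 10 ≤ y) :
    (word₁ r₁ r₂ * (word₂ r₁ r₂)⁻¹) y = y := by
  have hg : 9 ≤ plG y := by
    refine le_trans (le_of_eq ?_) (plG.monotone hy)
    rw [plG_right (by norm_num) (by norm_num)]
    norm_num
  have e : (word₂ r₁ r₂)⁻¹ y = plG⁻¹ y := inv_apply_of_apply_eq <| word₂_apply_eq <| by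
    rw [RelIso.apply_inv_self, twistF_of_ge h₁ h₂ hg]
  rw [RelIso.mul_apply, e]
  exact word₁_apply_eq (by rw [RelIso.apply_inv_self, twistF_of_ge h₁ h₂ (by linarith)])

theorem conj_apply_eq {α : Type*} [LE α] {u v : α ≃o α} {x : α} (h : v (u x) = u x) :
    (u⁻¹ * v * u) x = x := by
  rw [RelIso.mul_apply, RelIso.mul_apply, h, RelIso.inv_apply_self]

theorem commutator_apply_of_disjoint_Iic {u v : ℝ ≃o ℝ} {p : ℝ} (hu : u p = p) (hv : v p = p)
    (h : ∀ x ≤ p, u x = x ∨ v x = x) {x : ℝ} (hx : x ≤ p) : ⁅u, v⁆ x = x := by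
  have inv {φ : ℝ ≃o ℝ} (hφ : φ p = p) : ∀ x ∈ Set.Iic p, φ x ∈ Set.Iic p := fun x hx => by
    rw [← hφ]; exact φ.monotone hx
  exact commutator_apply_of_disjoint (inv hu) (inv (inv_apply_of_apply_eq hu)) (inv hv)
    (inv (inv_apply_of_apply_eq hv)) h hx

theorem commutator_apply_of_disjoint_Ici {u v : ℝ ≃o ℝ} {p : ℝ} (hu : u p = p) (hv : v p = p)
    (h : ∀ x, p ≤ x → u x = x ∨ v x = x) {x : ℝ} (hx : p ≤ x) : ⁅u, v⁆ x = x := by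
  have inv {φ : ℝ ≃o ℝ} (hφ : φ p = p) : ∀ x ∈ Set.Ici p, φ x ∈ Set.Ici p := fun x hx => by
    rw [← hφ]; exact φ.monotone hx
  exact commutator_apply_of_disjoint (inv hu) (inv (inv_apply_of_apply_eq hu)) (inv hv)
    (inv (inv_apply_of_apply_eq hv)) h hx

theorem word₂_mem_Icc (h₁ : SuppMid r₁) (h₂ : SuppMid r₂) {x : ℝ} (hx : x ∈ Set.Icc (2 : ℝ) 7) :
    word₂ r₁ r₂ x ∈ Set.Icc (6 : ℝ) 7 :=
  ⟨by rw [← word₂_two h₁ h₂]; exact (word₂ r₁ r₂).monotone hx.1,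
    by conv_rhs => rw [← word₂_seven h₁ h₂]
       exact (word₂ r₁ r₂).monotone hx.2⟩

theorem word₁_mem_Icc (h₁ : SuppMid r₁) (h₂ : SuppMid r₂) {x : ℝ} (hx : x ∈ Set.Icc (8 : ℝ) 10) :
    word₁ r₁ r₂ x ∈ Set.Icc (8 : ℝ) 9 :=
  ⟨by conv_lhs => rw [← word₁_eight h₁ h₂]
      exact (word₁ r₁ r₂).monotone hx.1,
    by rw [← word₁_ten h₁ h₂]; exact (word₁ r₁ r₂).monotone hx.2⟩

/-- To the left of `7`, the words satisfy the relations of Thompson's group. -/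
theorem commutator_words_left (h₁ : SuppMid r₁) (h₂ : SuppMid r₂) {x : ℝ} (hx : x ≤ 7) :
    ⁅word₂ r₁ r₂ * (word₁ r₁ r₂)⁻¹, (word₂ r₁ r₂)⁻¹ * word₁ r₁ r₂ * word₂ r₁ r₂⁆ x = x ∧
    ⁅word₂ r₁ r₂ * (word₁ r₁ r₂)⁻¹,
      (word₂ r₁ r₂ ^ 2)⁻¹ * word₁ r₁ r₂ * word₂ r₁ r₂ ^ 2⁆ x = x := by
  have h7 := word₁_seven h₁ h₂
  have h7' := word₂_seven h₁ h₂
  have hu : (word₂ r₁ r₂ * (word₁ r₁ r₂)⁻¹) 7 = 7 := by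
    rw [RelIso.mul_apply, inv_apply_of_apply_eq h7, h7']
  have hsq (x : ℝ) : (word₂ r₁ r₂ ^ 2) x = word₂ r₁ r₂ (word₂ r₁ r₂ x) := by
    rw [pow_two, RelIso.mul_apply]
  refine ⟨commutator_apply_of_disjoint_Iic hu (conj_apply_eq ?_) (fun x hx => ?_) hx,
    commutator_apply_of_disjoint_Iic hu (conj_apply_eq ?_) (fun x hx => ?_) hx⟩
  · rw [h7', h7]
  -- The supports are separated at `2`: `word₂` carries `[2, 7]` into `[6, 7]`, where `word₁` is
  -- trivial.
  · refine (le_total x 2).imp (word₂_mul_word₁_inv_apply h₁ h₂) fun h => conj_apply_eq ?_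
    exact word₁_of_mem_Icc h₁ h₂ (word₂_mem_Icc h₁ h₂ ⟨h, hx⟩)
  · rw [hsq, h7', h7', h7]
  · refine (le_total x 2).imp (word₂_mul_word₁_inv_apply h₁ h₂) fun h => conj_apply_eq ?_
    rw [hsq]
    have := word₂_mem_Icc h₁ h₂ ⟨h, hx⟩
    exact word₁_of_mem_Icc h₁ h₂ (word₂_mem_Icc h₁ h₂ ⟨by linarith [this.1], this.2⟩)

/-- To the right of `8`, the words in the opposite order satisfy the relations of Thompson's
group. -/
theorem commutator_words_right (h₁ : SuppMid r₁) (h₂ : SuppMid r₂) {x : ℝ} (hx : 8 ≤ x) :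
    ⁅word₁ r₁ r₂ * (word₂ r₁ r₂)⁻¹, (word₁ r₁ r₂)⁻¹ * word₂ r₁ r₂ * word₁ r₁ r₂⁆ x = x ∧
    ⁅word₁ r₁ r₂ * (word₂ r₁ r₂)⁻¹,
      (word₁ r₁ r₂ ^ 2)⁻¹ * word₂ r₁ r₂ * word₁ r₁ r₂ ^ 2⁆ x = x := by
  have h8 := word₁_eight h₁ h₂
  have h8' := word₂_eight h₁ h₂
  have hu : (word₁ r₁ r₂ * (word₂ r₁ r₂)⁻¹) 8 = 8 := by
    rw [RelIso.mul_apply, inv_apply_of_apply_eq h8', h8]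
  have hsq (x : ℝ) : (word₁ r₁ r₂ ^ 2) x = word₁ r₁ r₂ (word₁ r₁ r₂ x) := by
    rw [pow_two, RelIso.mul_apply]
  refine ⟨commutator_apply_of_disjoint_Ici hu (conj_apply_eq ?_) (fun x hx => ?_) hx,
    commutator_apply_of_disjoint_Ici hu (conj_apply_eq ?_) (fun x hx => ?_) hx⟩
  · rw [h8, h8']
  -- The supports are separated at `10`: `word₁` carries `[8, 10]` into `[8, 9]`, where `word₂` is
  -- trivial.
  · refine (le_total 10 x).imp (word₁_mul_word₂_inv_apply h₁ h₂) fun h => conj_apply_eq ?_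
    exact word₂_of_mem_Icc h₁ h₂ (word₁_mem_Icc h₁ h₂ ⟨hx, h⟩)
  · rw [hsq, h8, h8, h8']
  · refine (le_total 10 x).imp (word₁_mul_word₂_inv_apply h₁ h₂) fun h => conj_apply_eq ?_
    rw [hsq]
    have := word₁_mem_Icc h₁ h₂ ⟨hx, h⟩
    exact word₂_of_mem_Icc h₁ h₂ (word₁_mem_Icc h₁ h₂ ⟨this.1, by linarith [this.2]⟩)

/-! ### The squares generate Thompson's group -/

theorem twistF_le (h₁ : SuppMid r₁) (h₂ : SuppMid r₂) (x : ℝ) : twistF r₁ r₂ x ≤ x := by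
  rcases le_or_gt x 0 with h | h
  · exact (twistF_of_nonpos h₁ h₂ h).le
  rcases le_or_gt 9 x with h' | h'
  · exact (twistF_of_ge h₁ h₂ h').le
  · exact (twistF_lt h₁ h₂ h h').le

theorem plG_le (x : ℝ) : plG x ≤ x := by
  rcases le_or_gt x 2 with h | h
  · exact (plG_of_le h).le
  rcases le_or_gt 11 x with h' | h'
  · exact (plG_of_ge h').le
  · exact (plG_lt h h').le

theorem pow_apply_le {α : Type*} [Preorder α] {φ : α ≃o α} (h : ∀ x, φ x ≤ x) (n : ℕ) (x : α) :
    (φ ^ n) x ≤ x := by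
  induction n with
  | zero => simp
  | succ n ih =>
    rw [pow_succ', RelIso.mul_apply]
    exact (h _).trans ih

theorem squares_mul_le (h₁ : SuppMid r₁) (h₂ : SuppMid r₂) (x : ℝ) :
    (twistF r₁ r₂ ^ 2 * plG ^ 2) x ≤ x :=
  (pow_apply_le (twistF_le h₁ h₂) 2 _).trans (pow_apply_le plG_le 2 x)

/-- The orbit is `9, 7, 5, 3, 3/2`, and it avoids the open intervals where `f` is twisted. Squares
matter: `fg` sends `9` only to `5`, still inside `supp g`. -/
theorem squares_mul_nine (h₁ : SuppMid r₁) (h₂ : SuppMid r₂) :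
    (twistF r₁ r₂ ^ 2 * plG ^ 2) 9 ≤ 2 := by
  rw [RelIso.mul_apply, pow_two, pow_two, RelIso.mul_apply, RelIso.mul_apply,
    plG_sub_two (x := 9) (by norm_num) le_rfl, plG_sub_two (by norm_num) (by norm_num),
    twistF_sub_two h₁ h₂ (x := 9 - 2 - 2) (.inl (by norm_num)),
    twistF_half h₁ h₂ (by norm_num) (by norm_num)]
  norm_num

theorem squares_mul_pow_le (h₁ : SuppMid r₁) (h₂ : SuppMid r₂) (n : ℕ) {x : ℝ} (hx : x ≤ 9) :
    ((twistF r₁ r₂ ^ 2 * plG ^ 2) ^ (n + 1)) x ≤ 2 := by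
  rw [pow_succ, RelIso.mul_apply]
  exact (pow_apply_le (squares_mul_le h₁ h₂) n _).trans
    (((twistF r₁ r₂ ^ 2 * plG ^ 2).monotone hx).trans (squares_mul_nine h₁ h₂))

theorem plG_sq_of_le {x : ℝ} (hx : x ≤ 2) : (plG ^ 2) x = x := by
  rw [pow_two, RelIso.mul_apply, plG_of_le hx, plG_of_le hx]

/-- The supports are disjoint: `f²` is trivial right of `9`, and the conjugate is trivial left of
`9` because the conjugator pushes that side below `2`, where `g` is trivial. -/
theorem commutator_squares (h₁ : SuppMid r₁) (h₂ : SuppMid r₂) (n : ℕ) :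
    ⁅twistF r₁ r₂ ^ 2, ((twistF r₁ r₂ ^ 2 * plG ^ 2) ^ (n + 1))⁻¹ * plG ^ 2 *
      (twistF r₁ r₂ ^ 2 * plG ^ 2) ^ (n + 1)⁆ = 1 := by
  ext x
  refine commutator_apply_of_disjoint (D := Set.univ) (by simp) (by simp) (by simp) (by simp)
    (fun x _ => ?_) (Set.mem_univ x)
  refine (le_total 9 x).imp (fun h => ?_) fun h => conj_apply_eq ?_
  · rw [pow_two, RelIso.mul_apply, twistF_of_ge h₁ h₂ h, twistF_of_ge h₁ h₂ h]
  · rw [plG_sq_of_le (squares_mul_pow_le h₁ h₂ n h)]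

/-- The homomorphism from Thompson's group sending the generators to the squares. -/
noncomputable def squaresHom (h₁ : SuppMid r₁) (h₂ : SuppMid r₂) : ThompsonF →* (ℝ ≃o ℝ) :=
  PresentedGroup.toGroup (f := ![twistF r₁ r₂ ^ 2, plG ^ 2]) <| by
    rintro r (rfl | rfl)
    · simpa [map_commutatorElement] using commutator_squares h₁ h₂ 0
    · simpa [map_commutatorElement] using commutator_squares h₁ h₂ 1

theorem squaresHom_genA (h₁ : SuppMid r₁) (h₂ : SuppMid r₂) :
    squaresHom h₁ h₂ genA = twistF r₁ r₂ ^ 2 := by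
  simp [squaresHom, genA]

theorem squaresHom_genB (h₁ : SuppMid r₁) (h₂ : SuppMid r₂) :
    squaresHom h₁ h₂ genB = plG ^ 2 := by
  simp [squaresHom, genB]

theorem squaresHom_injective (h₁ : SuppMid r₁) (h₂ : SuppMid r₂) :
    Function.Injective (squaresHom h₁ h₂) := by
  set X := twistF r₁ r₂ ^ 2 * plG ^ 2 with hX
  have hx0 : squaresHom h₁ h₂ (xgen 0) = X := by
    simp [xgen, squaresHom_genA, squaresHom_genB, hX]
  have hx (n : ℕ) : squaresHom h₁ h₂ (xgen (n + 1)) = (X ^ n)⁻¹ * plG ^ 2 * X ^ n := by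
    simp [xgen, squaresHom_genA, squaresHom_genB, hX]
  -- The point `1` lies in `supp f` but left of `supp g`, so only `x₀` moves it. The point `X⁻ⁿ 9`
  -- is moved by `xₙ₊₁` since `g²` moves `9`; for a later generator the conjugating power of `X`
  -- first brings it below `2`.
  refine injective_of_test_points (y := fun k => Nat.casesOn k 1 fun n => (X ^ n)⁻¹ 9) ?_ ?_
  · rintro (_ | n)
    · change squaresHom h₁ h₂ (xgen 0) 1 < 1
      rw [hx0]
      have h1 : (plG ^ 2) 1 = 1 := plG_sq_of_le (by norm_num)
      rw [hX, RelIso.mul_apply, h1, pow_two, RelIso.mul_apply]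
      exact (twistF_le h₁ h₂ _).trans_lt (twistF_lt h₁ h₂ (by norm_num) (by norm_num))
    · change squaresHom h₁ h₂ (xgen (n + 1)) ((X ^ n)⁻¹ 9) < (X ^ n)⁻¹ 9
      rw [hx, RelIso.mul_apply, RelIso.mul_apply, RelIso.apply_inv_self, OrderIso.lt_iff_lt,
        pow_two, RelIso.mul_apply]
      exact (plG_le _).trans_lt (plG_lt (by norm_num) (by norm_num))
  · rintro (_ | n) j hj
    · obtain ⟨m, rfl⟩ := Nat.exists_eq_add_of_lt hj
      change squaresHom h₁ h₂ (xgen (0 + m + 1)) 1 = 1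
      rw [hx]
      refine conj_apply_eq (plG_sq_of_le ?_)
      exact (pow_apply_le (squares_mul_le h₁ h₂) _ _).trans (by norm_num)
    · obtain ⟨m, rfl⟩ := Nat.exists_eq_add_of_lt hj
      change squaresHom h₁ h₂ (xgen (n + 1 + m + 1)) ((X ^ n)⁻¹ 9) = (X ^ n)⁻¹ 9
      rw [hx]
      refine conj_apply_eq (plG_sq_of_le ?_)
      rw [show n + 1 + m = (m + 1) + n by omega, pow_add, RelIso.mul_apply, RelIso.apply_inv_self]
      exact squares_mul_pow_le h₁ h₂ m le_rfl

end Twist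

/-! ### Restriction to the unit interval -/

/-- The order automorphisms of `ℝ` which are the identity outside `(0, 11)`. -/
def compactSupp : Subgroup (ℝ ≃o ℝ) where
  carrier := {φ | ∀ x, x ∉ Set.Ioo (0 : ℝ) 11 → φ x = x}
  mul_mem' {φ ψ} hφ hψ x hx := by rw [RelIso.mul_apply, hψ x hx, hφ x hx]
  one_mem' _ _ := rfl
  inv_mem' {φ} hφ x hx := inv_apply_of_apply_eq (hφ x hx)

theorem compactSupp_apply_mem (φ : compactSupp) (x : unitInterval) :
    (φ : ℝ ≃o ℝ) (11 * x) / 11 ∈ unitInterval := by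
  have h := apply_mem_Icc φ.2 (x := 11 * (x : ℝ))
    ⟨by linarith [x.2.1], by linarith [x.2.2]⟩
  exact ⟨by linarith [h.1], by linarith [h.2]⟩

/-- The rescaling of an automorphism supported in `(0, 11)` to the unit interval. -/
noncomputable def rescale (φ : compactSupp) : unitInterval ≃o unitInterval :=
  Equiv.toOrderIso
    { toFun := fun x => ⟨(φ : ℝ ≃o ℝ) (11 * x) / 11, compactSupp_apply_mem φ x⟩
      invFun := fun x => ⟨((φ⁻¹ : compactSupp) : ℝ ≃o ℝ) (11 * x) / 11,
        compactSupp_apply_mem φ⁻¹ x⟩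
      left_inv := fun x => Subtype.ext <| by simp [mul_div_cancel₀]
      right_inv := fun x => Subtype.ext <| by simp [mul_div_cancel₀] }
    (fun x y h => Subtype.coe_le_coe.1 <| by
      have : (φ : ℝ ≃o ℝ) (11 * x) ≤ (φ : ℝ ≃o ℝ) (11 * y) :=
        (φ : ℝ ≃o ℝ).monotone (by gcongr)
      change (φ : ℝ ≃o ℝ) (11 * x) / 11 ≤ (φ : ℝ ≃o ℝ) (11 * y) / 11
      gcongr)
    (fun x y h => Subtype.coe_le_coe.1 <| by
      have : ((φ⁻¹ : compactSupp) : ℝ ≃o ℝ) (11 * x) ≤ ((φ⁻¹ : compactSupp) : ℝ ≃o ℝ) (11 * y) :=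
        ((φ⁻¹ : compactSupp) : ℝ ≃o ℝ).monotone (by gcongr)
      change ((φ⁻¹ : compactSupp) : ℝ ≃o ℝ) (11 * x) / 11 ≤
        ((φ⁻¹ : compactSupp) : ℝ ≃o ℝ) (11 * y) / 11
      gcongr)

/-- Rescaling as a homomorphism to the homeomorphism group of the unit interval. -/
noncomputable def toHomeoPlus : compactSupp →* HomeoPlus where
  toFun φ := ⟨(rescale φ).toHomeomorph, (rescale φ).strictMono⟩
  map_one' := by
    apply Subtype.ext
    ext x
    change (11 * (x : ℝ)) / 11 = x
    simp
  map_mul' φ ψ := by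
    apply Subtype.ext
    ext x
    change (φ : ℝ ≃o ℝ) ((ψ : ℝ ≃o ℝ) (11 * x)) / 11 =
      (φ : ℝ ≃o ℝ) (11 * ((ψ : ℝ ≃o ℝ) (11 * x) / 11)) / 11
    rw [mul_div_cancel₀ _ (by norm_num)]

theorem coe_toHomeoPlus_apply (φ : compactSupp) (x : unitInterval) :
    (((toHomeoPlus φ : unitInterval ≃ₜ unitInterval) x : unitInterval) : ℝ) =
      (φ : ℝ ≃o ℝ) (11 * x) / 11 := rfl

theorem toHomeoPlus_injective : Function.Injective toHomeoPlus := by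
  rw [injective_iff_map_eq_one]
  intro φ h
  apply Subtype.ext
  ext x
  by_cases hx : x ∈ Set.Ioo (0 : ℝ) 11
  · have h1 := coe_toHomeoPlus_apply φ
      ⟨x / 11, by linarith [hx.1], by linarith [hx.2]⟩
    rw [h] at h1
    have h2 : x / 11 = (φ : ℝ ≃o ℝ) (11 * (x / 11)) / 11 := h1
    rw [mul_div_cancel₀ _ (by norm_num)] at h2
    change (φ : ℝ ≃o ℝ) x = x
    linarith
  · exact φ.2 x hx

theorem mem_supp_toHomeoPlus {φ : compactSupp} {x : unitInterval} :
    x ∈ supp (toHomeoPlus φ) ↔ (φ : ℝ ≃o ℝ) (11 * x) ≠ 11 * x := by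
  rw [supp, Set.mem_ofPred_eq, Ne, Ne, Subtype.ext_iff, coe_toHomeoPlus_apply,
    div_eq_iff (by norm_num), mul_comm (x : ℝ)]

theorem supp_toHomeoPlus {φ : compactSupp} {a b : unitInterval}
    (h : ∀ x, (φ : ℝ ≃o ℝ) x ≠ x ↔ x ∈ Set.Ioo (11 * a : ℝ) (11 * b)) :
    supp (toHomeoPlus φ) = Set.Ioo a b := by
  ext x
  rw [mem_supp_toHomeoPlus, h, Set.mem_Ioo, Set.mem_Ioo, mul_lt_mul_iff_right₀ (by norm_num),
    mul_lt_mul_iff_right₀ (by norm_num), Subtype.coe_lt_coe, Subtype.coe_lt_coe]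

theorem isTwoChain_Ioo {a b c d : unitInterval} (hac : a < c) (hcb : c < b) (hbd : b < d) :
    IsTwoChain (Set.Ioo a b) (Set.Ioo c d) := by
  have hinter : Set.Ioo a b ∩ Set.Ioo c d = Set.Ioo c b := by
    rw [Set.Ioo_inter_Ioo, sup_of_le_right hac.le, inf_of_le_left hbd.le]
  refine ⟨⟨a, b, hac.trans hcb, rfl⟩, ⟨c, d, hcb.trans hbd, rfl⟩, ⟨c, b, hcb, hinter⟩, ?_, ?_⟩
  · rw [hinter, Set.ssubset_iff_of_subset (Set.Ioo_subset_Ioo_left hac.le)]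
    exact ⟨c, ⟨hac, hcb⟩, by simp⟩
  · rw [hinter, Set.ssubset_iff_of_subset (Set.Ioo_subset_Ioo_right hbd.le)]
    exact ⟨b, ⟨hcb, hbd⟩, by simp⟩

section Square

variable {r₁ r₂ : ℝ ≃o ℝ}

theorem twistF_mem (h₁ : SuppMid r₁) (h₂ : SuppMid r₂) : twistF r₁ r₂ ∈ compactSupp := by
  intro x hx
  rw [Set.mem_Ioo, not_and_or, not_lt, not_lt] at hx
  rcases hx with h | h
  · exact twistF_of_nonpos h₁ h₂ h
  · exact twistF_of_ge h₁ h₂ (by linarith)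

theorem plG_mem : plG ∈ compactSupp := by
  intro x hx
  rw [Set.mem_Ioo, not_and_or, not_lt, not_lt] at hx
  rcases hx with h | h
  · exact plG_of_le (by linarith)
  · exact plG_of_ge h

/-- The first generator of the square root. -/
noncomputable def rootF (h₁ : SuppMid r₁) (h₂ : SuppMid r₂) : HomeoPlus :=
  toHomeoPlus ⟨twistF r₁ r₂, twistF_mem h₁ h₂⟩

/-- The second generator of the square root. -/
noncomputable def rootG : HomeoPlus := toHomeoPlus ⟨plG, plG_mem⟩

theorem isTwoChain_root (h₁ : SuppMid r₁) (h₂ : SuppMid r₂) :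
    IsTwoChain (supp (rootF h₁ h₂)) (supp rootG) := by
  let b : unitInterval := ⟨9 / 11, by norm_num, by norm_num⟩
  let c : unitInterval := ⟨2 / 11, by norm_num, by norm_num⟩
  have hF : supp (rootF h₁ h₂) = Set.Ioo 0 b := supp_toHomeoPlus fun x => by
    have e : (11 * (b : ℝ)) = 9 := by change (11 * (9 / 11) : ℝ) = 9; norm_num
    rw [e, Set.Icc.coe_zero, mul_zero]
    refine ⟨fun h => ⟨not_le.1 fun h' => h (twistF_of_nonpos h₁ h₂ h'),
      not_le.1 fun h' => h (twistF_of_ge h₁ h₂ h')⟩, fun h => (twistF_lt h₁ h₂ h.1 h.2).ne⟩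
  have hG : supp rootG = Set.Ioo c 1 := supp_toHomeoPlus fun x => by
    have e : (11 * (c : ℝ)) = 2 := by change (11 * (2 / 11) : ℝ) = 2; norm_num
    rw [e, Set.Icc.coe_one, mul_one]
    exact ⟨fun h => ⟨not_le.1 fun h' => h (plG_of_le h'),
      not_le.1 fun h' => h (plG_of_ge h')⟩, fun h => (plG_lt h.1 h.2).ne⟩
  rw [hF, hG]
  refine isTwoChain_Ioo ?_ ?_ ?_ <;> rw [← Subtype.coe_lt_coe] <;> norm_num [b, c]

theorem squaresHom_mem (h₁ : SuppMid r₁) (h₂ : SuppMid r₂) (z : ThompsonF) :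
    squaresHom h₁ h₂ z ∈ compactSupp := by
  have hz : z ∈ Subgroup.closure {genA, genB} := by rw [closure_genA_genB]; trivial
  have hle : Subgroup.closure {genA, genB} ≤ compactSupp.comap (squaresHom h₁ h₂) := by
    rw [Subgroup.closure_le]
    rintro _ (rfl | rfl)
    · change squaresHom h₁ h₂ genA ∈ compactSupp
      rw [squaresHom_genA]
      exact pow_mem (twistF_mem h₁ h₂) 2
    · change squaresHom h₁ h₂ genB ∈ compactSupp
      rw [squaresHom_genB]
      exact pow_mem plG_mem 2
  exact hle hz

theorem isSquareRootOfF_closure (h₁ : SuppMid r₁) (h₂ : SuppMid r₂) :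
    IsSquareRootOfF (Subgroup.closure {rootF h₁ h₂, rootG}) := by
  refine ⟨rootF h₁ h₂, rootG, rfl, isTwoChain_root h₁ h₂, ?_⟩
  let Θ : ThompsonF →* HomeoPlus :=
    toHomeoPlus.comp ((squaresHom h₁ h₂).codRestrict compactSupp (squaresHom_mem h₁ h₂))
  have hinj : Function.Injective Θ := toHomeoPlus_injective.comp fun x y h =>
    squaresHom_injective h₁ h₂ (congr_arg Subtype.val h)
  have hA : Θ genA = rootF h₁ h₂ ^ 2 := by
    rw [rootF, ← map_pow]
    exact congr_arg toHomeoPlus (Subtype.ext (squaresHom_genA h₁ h₂))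
  have hB : Θ genB = rootG ^ 2 := by
    rw [rootG, ← map_pow]
    exact congr_arg toHomeoPlus (Subtype.ext (squaresHom_genB h₁ h₂))
  have hrange : Θ.range = Subgroup.closure {rootF h₁ h₂ ^ 2, rootG ^ 2} := by
    rw [MonoidHom.range_eq_map, ← closure_genA_genB, MonoidHom.map_closure, Set.image_pair, hA, hB]
  rw [← hrange]
  exact ⟨(MonoidHom.ofInjective hinj).symm⟩

end Square

/-! ### Embedding the extension -/

/-- The elements acting trivially on an invariant set. -/
def fixSubgroup {K α : Type*} [Group K] [LE α] (Ψ : K →* (α ≃o α)) (D : Set α) : Subgroup K where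
  carrier := {v | ∀ x ∈ D, Ψ v x = x}
  mul_mem' {v w} hv hw x hx := by rw [map_mul, RelIso.mul_apply, hw x hx, hv x hx]
  one_mem' x _ := by rw [map_one]; rfl
  inv_mem' {v} hv x hx := by rw [map_inv]; exact inv_apply_of_apply_eq (hv x hx)

theorem fixSubgroup_normal {K α : Type*} [Group K] [LE α] {Ψ : K →* (α ≃o α)} {D : Set α}
    (hD : ∀ v, ∀ x ∈ D, Ψ v x ∈ D) : (fixSubgroup Ψ D).Normal where
  conj_mem v hv w x hx := by
    rw [map_mul, map_mul, RelIso.mul_apply, RelIso.mul_apply, hv _ (hD _ _ hx), map_inv,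
      RelIso.apply_inv_self]

/-- A word which is trivial in the presented group acts trivially wherever the relators do. -/
theorem apply_eq_of_mk_eq_one {ι α : Type*} [LE α] {rels : Set (FreeGroup ι)}
    {Ψ : FreeGroup ι →* (α ≃o α)} {D : Set α} (hD : ∀ v, ∀ x ∈ D, Ψ v x ∈ D)
    (hrels : ∀ r ∈ rels, ∀ x ∈ D, Ψ r x = x) {v : FreeGroup ι}
    (hv : PresentedGroup.mk rels v = 1) {x : α} (hx : x ∈ D) : Ψ v x = x := by
  -- Invariance of `D` makes its pointwise stabilizer normal, so it contains the normal closure of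
  -- the relators.
  have hn := fixSubgroup_normal hD
  have hle : Subgroup.normalClosure rels ≤ fixSubgroup Ψ D := Subgroup.normalClosure_le_normal hrels
  exact hle ((QuotientGroup.eq_one_iff v).1 hv) x hx

theorem freeGroup_apply_eq_of_generators {ι α : Type*} [LE α] {Ψ : FreeGroup ι →* (α ≃o α)} {p : α}
    (h : ∀ i, Ψ (FreeGroup.of i) p = p) (v : FreeGroup ι) : Ψ v p = p := by
  have hle : (⊤ : Subgroup (FreeGroup ι)) ≤ fixSubgroup Ψ {p} := by
    rw [← FreeGroup.closure_range_of, Subgroup.closure_le]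
    rintro _ ⟨i, rfl⟩ x rfl
    exact h i
  exact hle trivial p rfl

section Embedding

variable {r₁ r₂ : ℝ ≃o ℝ}

/-- The homomorphism from the free group given by the two words. -/
noncomputable def wordsHom (r₁ r₂ : ℝ ≃o ℝ) : FreeGroup (Fin 2) →* (ℝ ≃o ℝ) :=
  FreeGroup.lift ![word₁ r₁ r₂, word₂ r₁ r₂]

theorem wordsHom_of_zero : wordsHom r₁ r₂ (FreeGroup.of 0) = word₁ r₁ r₂ := by simp [wordsHom]

theorem wordsHom_of_one : wordsHom r₁ r₂ (FreeGroup.of 1) = word₂ r₁ r₂ := by simp [wordsHom]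

theorem wordsHom_seven (h₁ : SuppMid r₁) (h₂ : SuppMid r₂) (v : FreeGroup (Fin 2)) :
    wordsHom r₁ r₂ v 7 = 7 :=
  freeGroup_apply_eq_of_generators (Fin.forall_fin_two.2
    ⟨by rw [wordsHom_of_zero, word₁_seven h₁ h₂], by rw [wordsHom_of_one, word₂_seven h₁ h₂]⟩) v

theorem wordsHom_eight (h₁ : SuppMid r₁) (h₂ : SuppMid r₂) (v : FreeGroup (Fin 2)) :
    wordsHom r₁ r₂ v 8 = 8 :=
  freeGroup_apply_eq_of_generators (Fin.forall_fin_two.2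
    ⟨by rw [wordsHom_of_zero, word₁_eight h₁ h₂], by rw [wordsHom_of_one, word₂_eight h₁ h₂]⟩) v

/-- The automorphism of the free group of rank two exchanging the generators. -/
def swapGens : FreeGroup (Fin 2) →* FreeGroup (Fin 2) :=
  FreeGroup.lift ![FreeGroup.of 1, FreeGroup.of 0]

theorem swapGens_of_zero : swapGens (FreeGroup.of 0) = FreeGroup.of 1 := by simp [swapGens]

theorem swapGens_of_one : swapGens (FreeGroup.of 1) = FreeGroup.of 0 := by simp [swapGens]

theorem swapGens_swapGens (v : FreeGroup (Fin 2)) : swapGens (swapGens v) = v := by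
  have : swapGens.comp swapGens = MonoidHom.id _ := by
    refine FreeGroup.ext_hom _ _ (Fin.forall_fin_two.2 ⟨?_, ?_⟩) <;>
      simp [swapGens_of_zero, swapGens_of_one]
  exact DFunLike.congr_fun this v

theorem wordsHom_apply_right (h₁ : SuppMid r₁) (h₂ : SuppMid r₂) {v : FreeGroup (Fin 2)}
    (hv : PresentedGroup.mk relsNested v = 1) {x : ℝ} (hx : 8 ≤ x) : wordsHom r₁ r₂ v x = x := by
  refine apply_eq_of_mk_eq_one (D := Set.Ici 8) (fun w x hx => ?_) ?_ hv hx
  · rw [← wordsHom_eight h₁ h₂ w]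
    exact (wordsHom r₁ r₂ w).monotone hx
  · rintro _ (rfl | rfl) x hx
    · refine Eq.trans (DFunLike.congr_fun ?_ x) (commutator_words_right h₁ h₂ hx).1
      simp only [map_commutatorElement, map_mul, map_inv, wordsHom_of_zero, wordsHom_of_one]
    · refine Eq.trans (DFunLike.congr_fun ?_ x) (commutator_words_right h₁ h₂ hx).2
      simp only [map_commutatorElement, map_mul, map_inv, map_pow, wordsHom_of_zero,
        wordsHom_of_one]

theorem wordsHom_apply_left (h₁ : SuppMid r₁) (h₂ : SuppMid r₂) {v : FreeGroup (Fin 2)}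
    (hv : PresentedGroup.mk relsNested (swapGens v) = 1) {x : ℝ} (hx : x ≤ 7) :
    wordsHom r₁ r₂ v x = x := by
  rw [← swapGens_swapGens v]
  refine apply_eq_of_mk_eq_one (Ψ := (wordsHom r₁ r₂).comp swapGens) (D := Set.Iic 7)
    (fun w x hx => ?_) ?_ hv hx
  · rw [← wordsHom_seven h₁ h₂ (swapGens w)]
    exact (wordsHom r₁ r₂ (swapGens w)).monotone hx
  · rintro _ (rfl | rfl) x hx
    · refine Eq.trans (DFunLike.congr_fun ?_ x) (commutator_words_left h₁ h₂ hx).1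
      simp only [map_commutatorElement, map_mul, map_inv, MonoidHom.comp_apply,
        swapGens_of_zero, swapGens_of_one, wordsHom_of_zero, wordsHom_of_one]
    · refine Eq.trans (DFunLike.congr_fun ?_ x) (commutator_words_left h₁ h₂ hx).2
      simp only [map_commutatorElement, map_mul, map_inv, map_pow, MonoidHom.comp_apply,
        swapGens_of_zero, swapGens_of_one, wordsHom_of_zero, wordsHom_of_one]

theorem wordsHom_apply_middle (h₁ : SuppMid r₁) (h₂ : SuppMid r₂) (v : FreeGroup (Fin 2)) {x : ℝ}
    (hx : x ∈ Set.Icc (7 : ℝ) 8) : wordsHom r₁ r₂ v x = FreeGroup.lift ![r₁, r₂] v x := by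
  have hmem : ∀ v x, x ∈ Set.Icc (7 : ℝ) 8 → wordsHom r₁ r₂ v x ∈ Set.Icc (7 : ℝ) 8 := by
    intro v x hx
    refine ⟨?_, ?_⟩
    · conv_lhs => rw [← wordsHom_seven h₁ h₂ v]
      exact (wordsHom r₁ r₂ v).monotone hx.1
    · conv_rhs => rw [← wordsHom_eight h₁ h₂ v]
      exact (wordsHom r₁ r₂ v).monotone hx.2
  have hof : ∀ i x, x ∈ Set.Icc (7 : ℝ) 8 →
      wordsHom r₁ r₂ (FreeGroup.of i) x = FreeGroup.lift ![r₁, r₂] (FreeGroup.of i) x := by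
    refine Fin.forall_fin_two.2 ⟨fun x hx => ?_, fun x hx => ?_⟩
    · rw [wordsHom_of_zero, word₁_middle h₁ h₂ hx]; simp
    · rw [wordsHom_of_one, word₂_middle h₁ hx]; simp
  induction v using FreeGroup.induction_on generalizing x with
  | C1 => simp
  | of i => exact hof i x hx
  | inv_of i _ =>
    have h := hof i (wordsHom r₁ r₂ (FreeGroup.of i)⁻¹ x) (hmem _ _ hx)
    rw [map_inv, RelIso.apply_inv_self] at h
    rw [map_inv, map_inv, inv_apply_of_apply_eq h.symm]
  | mul v w ihv ihw =>
    rw [map_mul, map_mul, RelIso.mul_apply, RelIso.mul_apply, ihv (hmem _ _ hx), ihw hx]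

theorem wordsHom_mem (h₁ : SuppMid r₁) (h₂ : SuppMid r₂) (v : FreeGroup (Fin 2)) :
    wordsHom r₁ r₂ v ∈ compactSupp := by
  have hf := twistF_mem h₁ h₂
  have hg := plG_mem
  have hw : word₁ r₁ r₂ ∈ compactSupp := mul_mem (inv_mem hf) hg
  have hof : ∀ i, wordsHom r₁ r₂ (FreeGroup.of i) ∈ compactSupp :=
    Fin.forall_fin_two.2 ⟨by rwa [wordsHom_of_zero],
      by rw [wordsHom_of_one]; exact mul_mem (mul_mem (inv_mem hg) hw) hg⟩
  induction v using FreeGroup.induction_on with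
  | C1 => rw [map_one]; exact one_mem _
  | of i => exact hof i
  | inv_of i _ => rw [map_inv]; exact inv_mem (hof i)
  | mul v w ihv ihw => rw [map_mul]; exact mul_mem ihv ihw

/-- The action of the free group on the unit interval by the two words. -/
noncomputable def wordsHomeo (h₁ : SuppMid r₁) (h₂ : SuppMid r₂) : FreeGroup (Fin 2) →* HomeoPlus :=
  toHomeoPlus.comp ((wordsHom r₁ r₂).codRestrict compactSupp (wordsHom_mem h₁ h₂))

theorem wordsHomeo_eq_one_iff (h₁ : SuppMid r₁) (h₂ : SuppMid r₂) {v : FreeGroup (Fin 2)} :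
    wordsHomeo h₁ h₂ v = 1 ↔ wordsHom r₁ r₂ v = 1 := by
  rw [wordsHomeo, MonoidHom.comp_apply, map_eq_one_iff _ toHomeoPlus_injective,
    Subtype.ext_iff]
  rfl

theorem wordsHomeo_mem (h₁ : SuppMid r₁) (h₂ : SuppMid r₂) (v : FreeGroup (Fin 2)) :
    wordsHomeo h₁ h₂ v ∈ Subgroup.closure {rootF h₁ h₂, rootG} := by
  have hf : rootF h₁ h₂ ∈ Subgroup.closure {rootF h₁ h₂, rootG} :=
    Subgroup.subset_closure (by simp)
  have hg : rootG ∈ Subgroup.closure {rootF h₁ h₂, rootG} := Subgroup.subset_closure (by simp)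
  have h0 : wordsHomeo h₁ h₂ (FreeGroup.of 0) = (rootF h₁ h₂)⁻¹ * rootG := by
    rw [rootF, rootG, ← map_inv, ← map_mul]
    exact congr_arg toHomeoPlus (Subtype.ext wordsHom_of_zero)
  have h1 : wordsHomeo h₁ h₂ (FreeGroup.of 1) =
      rootG⁻¹ * ((rootF h₁ h₂)⁻¹ * rootG) * rootG := by
    rw [rootF, rootG, ← map_inv, ← map_inv, ← map_mul, ← map_mul, ← map_mul]
    exact congr_arg toHomeoPlus (Subtype.ext wordsHom_of_one)
  have hof : ∀ i, wordsHomeo h₁ h₂ (FreeGroup.of i) ∈ Subgroup.closure {rootF h₁ h₂, rootG} :=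
    Fin.forall_fin_two.2 ⟨h0 ▸ mul_mem (inv_mem hf) hg,
      h1 ▸ mul_mem (mul_mem (inv_mem hg) (mul_mem (inv_mem hf) hg)) hg⟩
  induction v using FreeGroup.induction_on with
  | C1 => rw [map_one]; exact one_mem _
  | of i => exact hof i
  | inv_of i _ => rw [map_inv]; exact inv_mem (hof i)
  | mul v w ihv ihw => rw [map_mul]; exact mul_mem ihv ihw

end Embedding

theorem surjective_lift_of_closure_eq_top {H : Type*} [Group H] {h₁ h₂ : H}
    (h : Subgroup.closure {h₁, h₂} = ⊤) :
    Function.Surjective (FreeGroup.lift ![h₁, h₂] : FreeGroup (Fin 2) →* H) := by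
  rw [← MonoidHom.range_eq_top, FreeGroup.range_lift_eq_closure, ← h]
  simp [Set.pair_comm]

end SquareRootsOfF

theorem theorem1p5 {H : Type*} [Group H] (h₁ h₂ : H)
    (hmarked : SquareRootsOfF.IsMarkedExtension h₁ h₂)
    (hlo : SquareRootsOfF.LeftOrderable H) :
    ∃ G : Subgroup SquareRootsOfF.HomeoPlus, SquareRootsOfF.IsSquareRootOfF G ∧
      ∃ φ : H →* G, Function.Injective φ := by
  open SquareRootsOfF in
  obtain ⟨hgen, π, -, hπ₁, hπ₂⟩ := hmarked
  have hq := surjective_lift_of_closure_eq_top hgen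
  set q : FreeGroup (Fin 2) →* H := FreeGroup.lift ![h₁, h₂] with hq_def
  have : Countable H := hq.countable
  obtain ⟨ρ, hρ, hfix⟩ := exists_action_real hlo (a := 7) (b := 8) (by norm_num)
  have hmid (h : H) : SuppMid (ρ h) := fun x hx => hfix h x (by simpa using hx)
  have hρq : FreeGroup.lift ![ρ h₁, ρ h₂] = ρ.comp q :=
    FreeGroup.ext_hom _ _ (Fin.forall_fin_two.2 ⟨by simp [q], by simp [q]⟩)
  -- The first coordinate of `P` controls the right side, where the first word plays `a`; the
  -- second, with generators exchanged, controls the left.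
  have hfst : ((MonoidHom.fst _ _).comp (P.subtype.comp π)).comp q =
      PresentedGroup.mk relsNested :=
    FreeGroup.ext_hom _ _ (Fin.forall_fin_two.2
      ⟨by simp [q, hπ₁, gen₁, PresentedGroup.of], by simp [q, hπ₂, gen₂, PresentedGroup.of]⟩)
  have hsnd : ((MonoidHom.snd _ _).comp (P.subtype.comp π)).comp q =
      (PresentedGroup.mk relsNested).comp swapGens :=
    FreeGroup.ext_hom _ _ (Fin.forall_fin_two.2
      ⟨by simp [q, hπ₁, gen₂, PresentedGroup.of, swapGens_of_zero],
        by simp [q, hπ₂, gen₁, PresentedGroup.of, swapGens_of_one]⟩)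
  -- Faithfulness of `ρ` on the middle interval gives one direction; the other checks the three
  -- invariant pieces cut at `7` and `8`.
  have key (v : FreeGroup (Fin 2)) : wordsHom (ρ h₁) (ρ h₂) v = 1 ↔ q v = 1 := by
    have hm {x : ℝ} (hx : x ∈ Set.Icc (7 : ℝ) 8) :
        wordsHom (ρ h₁) (ρ h₂) v x = ρ (q v) x := by
      rw [wordsHom_apply_middle (hmid _) (hmid _) v hx, hρq, MonoidHom.comp_apply]
    constructor
    · intro hv
      apply hρ
      rw [map_one]
      ext x
      by_cases hx : x ∈ Set.Ioo (7 : ℝ) 8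
      · rw [← hm ⟨hx.1.le, hx.2.le⟩, hv]
      · exact hmid _ x hx
    · intro hv
      ext x
      rcases le_total x 7 with h | h
      · refine wordsHom_apply_left (hmid _) (hmid _) ?_ h
        rw [← MonoidHom.comp_apply, ← hsnd, MonoidHom.comp_apply, hv, map_one]
      rcases le_total 8 x with h' | h'
      · refine wordsHom_apply_right (hmid _) (hmid _) ?_ h'
        rw [← hfst, MonoidHom.comp_apply, hv, map_one]
      · rw [hm ⟨h, h'⟩, hv, map_one]
  let Φ := (wordsHomeo (hmid h₁) (hmid h₂)).codRestrict _ (wordsHomeo_mem (hmid h₁) (hmid h₂))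
  have hΦ (v : FreeGroup (Fin 2)) : Φ v = 1 ↔ q v = 1 := by
    rw [← key, ← wordsHomeo_eq_one_iff (hmid h₁) (hmid h₂), Subtype.ext_iff]
    rfl
  -- Equality of the kernels of `Φ` and `q` both lets `Φ` descend to `H` and makes the descended map
  -- injective.
  refine ⟨_, isSquareRootOfF_closure (hmid h₁) (hmid h₂),
    q.liftOfSurjective hq ⟨Φ, fun v hv => (hΦ v).2 hv⟩, ?_⟩
  rw [injective_iff_map_eq_one]
  intro h hh
  obtain ⟨v, rfl⟩ := hq h
  rw [MonoidHom.liftOfSurjective, MonoidHom.liftOfRightInverse_comp_apply] at hh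
  exact (hΦ v).1 hh
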